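/- Let $n\ge 0$ and $\hbar>0$. **Ensembles of $d$-level particles.** Let $\mathcal H=(\mathbb C^d)^{\otimes n}$. For a $d\times d$ matrix $x$ write $x^{(n)}=\sum_{k}1\otimes\cdots\otimes x\otimes\cdots\otimes 1$ for the collective operator on $\mathcal H$. The roots of $su(d)$ are $\mu=\varepsilon_i-\varepsilon_j$ with $i\neq j$; the corresponding non-diagonal generators are $e_\mu=c_\mu|i\rangle\langle j|$ with normalisations $c_\mu\neq 0$, $c_{-\mu}=\overline{c_\mu}$ (so $e_\mu^\dagger=e_{-\mu}$), and $E_\mu=e_\mu^{(n)}$. Let $H$ be a Hermitian operator on $\mathcal H$ that is invariant under all permutations of the particles. For a Bohr frequency $\omega$ (a difference of eigenvalues of $H$ divided by $\hbar$) let $E_\mu(\omega)$ be the component of $E_\mu$ with $[H,E_\mu(\omega)]=\hbar\omega E_\mu(\omega)$, so that $E_\mu=\sum_\omega E_\mu(\omega)$. For each Bohr frequency let $\Gamma_\omega=(\Gamma_\omega^{\mu\nu})$ be a positive semidefinite Hermitian matrix indexed by the roots, and consider the Lindblad generator $$\mathcal L(\rho)=-\frac{i}{\hbar}[H,\rho]+\sum_\omega\sum_{\mu,\nu}\Gamma_\omega^{\mu\nu}\Big[E_\mu(\omega)\rho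 E_\nu(\omega)^\dagger-\tfrac12\{E_\nu(\omega)^\dagger E_\mu(\omega),\rho\}\Big].$$ Assume that there is a complete set $R$ of simple roots such that, for each Bohr frequency $\omega$, $\Gamma_\omega$ has full rank over the roots $\mu\in R\cup(-R)$ with $E_\mu(\omega)\neq0$, in the following sense: the range of the block of $\Gamma_\omega$ on $\{\nu: E_\nu(\omega)\ne 0\}$ contains the coordinate vector of each such $\mu$. (This holds, for instance, if that block is invertible; and if the only nonzero entries of that block are between roots of $R\cup(-R)$, it says that the part of the block on those roots is invertible.) A Schur basis is an orthonormal basis identifying $\mathcal H$ with $\bigoplus_\lambda\mathcal K^\lambda\otimes\mathcal H^\lambda$ such that every $x^{(n)}$, $x\in su(d)$, takes the form $\bigoplus_\lambda 1_{\mathcal K^\lambda}\otimes x^\lambda$, with irreducible and pairwise inequivalent representations $x\mapsto x^\lambda$ on the $\mathcal H^\lambda$. Then a Schur basis exists, and in any Schur basis there are fixed density matrices $\rho^\lambda$ on $\mathcal H^\lambda$ such that a density matrix $\rho_\infty$ satisfies $\mathcal L(\rho_\infty)=0$ if and only if $$\rho_\infty=\bigoplus_\lambda p^\lambda\,\sigma^\lambda\otimes\rho^\lambda$$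 for some probabilities $p^\lambda\ge0$, $\sum_\lambda p^\lambda=1$, and some density matrices $\sigma^\lambda$ on $\mathcal K^\lambda$; the $p^\lambda$ and $\sigma^\lambda$ are arbitrary, while $\rho^\lambda$ is unique on each irrep: for any density matrix $\sigma$ on $\mathcal K^\lambda$, it is the only density matrix $\theta$ on $\mathcal H^\lambda$ for which $\sigma\otimes\theta$, placed in block $\lambda$, is a steady state. **Spin-$s$ ensembles.** The same conclusion, with total angular momentum $J$ in place of $\lambda$, holds for $n$ particles of spin $s\in\{0,\tfrac12,1,\dots\}$ on $(\mathbb C^{2s+1})^{\otimes n}$, with collective spin operators $S_{x,y,z}^{(n)}$ in place of $su(d)$, with $E_\pm=S_x^{(n)}\pm iS_y^{(n)}$ (the roots of $su(2)$), for every Hermitian $H$ in the algebra generated by $1$ and $S_{x,y,z}^{(n)}$ (equivalently, $H=\bigoplus_J 1_{\mathcal K^J}\otimes H^J$), and under the same assumptions on $\Gamma_\omega$. -/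

import Mathlib

open scoped ComplexOrder Kronecker

noncomputable section

/-! ## Ensembles of `n` particles with single-particle space `ℂ^d`

The ensemble Hilbert space `(ℂ^d)^{⊗ n}` has the product basis indexed by `Fin n → Fin d`. -/

/-- The collective operator `∑ₖ 1 ⊗ ⋯ ⊗ x ⊗ ⋯ ⊗ 1` (with `x` in the `k`-th factor). -/
def collective (n : ℕ) {d : ℕ} (x : Matrix (Fin d) (Fin d) ℂ) :
    Matrix (Fin n → Fin d) (Fin n → Fin d) ℂ :=
  Matrix.of fun i j => ∑ k : Fin n, x (i k) (j k) *
    ∏ l ∈ Finset.univ.erase k, (1 : Matrix (Fin d) (Fin d) ℂ) (i l) (j l)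

/-- Invariance under all permutations of the particles. -/
def IsPermutationInvariant {n d : ℕ} (O : Matrix (Fin n → Fin d) (Fin n → Fin d) ℂ) : Prop :=
  ∀ (π : Equiv.Perm (Fin n)) (i j : Fin n → Fin d), O (i ∘ π) (j ∘ π) = O i j

/-! ## The Lie algebra `su(d)`: generators, roots, simple roots -/

/-- The Hermitian generators of `SU(d)`: traceless Hermitian `d × d` matrices. -/
def SuGenerator (d : ℕ) : Type :=
  {x : Matrix (Fin d) (Fin d) ℂ // x.IsHermitian ∧ x.trace = 0}

/-- The roots `ε_i - ε_j`, `i ≠ j`, of `su(d)` with respect to the diagonal Cartan subalgebra. -/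
abbrev SuRoot (d : ℕ) : Type := {p : Fin d × Fin d // p.1 ≠ p.2}

namespace SuRoot

variable {d : ℕ}

/-- The negative root. -/
def neg (μ : SuRoot d) : SuRoot d := ⟨(μ.1.2, μ.1.1), Ne.symm μ.2⟩

/-- The root vector, with the functional `diag(a) ↦ ∑ₖ vₖ aₖ` written as the vector `v`. -/
def vec (μ : SuRoot d) : Fin d → ℝ := Pi.single μ.1.1 1 - Pi.single μ.1.2 1

/-- The non-diagonal generator `e_μ = c |i⟩⟨j|` for the root `ε_i - ε_j`, with normalisation
`c`. -/
def gen (c : ℂ) (μ : SuRoot d) : Matrix (Fin d) (Fin d) ℂ := Matrix.single μ.1.1 μ.1.2 c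

end SuRoot

/-- `R` is a complete set of simple roots of `su(d)`: the root vectors of `R` are linearly
independent, and every root vector is an integer combination of them with coefficients that are
either all non-negative or all non-positive. -/
def IsSimpleRoots {d : ℕ} (R : Finset (SuRoot d)) : Prop :=
  LinearIndependent ℝ (fun μ : R => μ.1.vec) ∧
  ∀ ν : SuRoot d, ∃ c : SuRoot d → ℤ,
    ((∀ μ ∈ R, 0 ≤ c μ) ∨ (∀ μ ∈ R, c μ ≤ 0)) ∧ ν.vec = ∑ μ ∈ R, (c μ : ℝ) • μ.vec

/-! ## Spin matrices

The spin is `s = N / 2`; the basis vector with index `a : Fin (N + 1)` has `m = s - a`. -/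

/-- The raising operator: `S₊ |m⟩ = √(s(s+1) - m(m+1)) |m+1⟩`. -/
def spinPlus (N : ℕ) : Matrix (Fin (N + 1)) (Fin (N + 1)) ℂ :=
  Matrix.of fun a b => if (a : ℕ) + 1 = (b : ℕ) then
    ((Real.sqrt ((N / 2 : ℝ) * (N / 2 + 1) - (N / 2 - b) * (N / 2 - b + 1)) : ℝ) : ℂ) else 0

/-- The lowering operator. -/
def spinMinus (N : ℕ) : Matrix (Fin (N + 1)) (Fin (N + 1)) ℂ := (spinPlus N).conjTranspose

/-- The three spin operators `S_x, S_y, S_z`. -/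
def spinXYZ (N : ℕ) : Fin 3 → Matrix (Fin (N + 1)) (Fin (N + 1)) ℂ :=
  ![(1 / 2 : ℂ) • (spinPlus N + spinMinus N),
    (1 / (2 * Complex.I) : ℂ) • (spinPlus N - spinMinus N),
    Matrix.diagonal fun a => (N / 2 - (a : ℕ) : ℂ)]

/-- The operator representing the non-diagonal generator of `su(2)`: `S₊` for the root
`ε_0 - ε_1` and `S₋` for its negative. -/
def spinLadder (N : ℕ) (μ : SuRoot 2) : Matrix (Fin (N + 1)) (Fin (N + 1)) ℂ :=
  if μ.1.1 = 0 then spinPlus N else spinMinus N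

/-! ## Bohr-frequency components and the Lindblad generator -/

section Lindblad

variable {m : Type} [Fintype m] [DecidableEq m]

open Classical in
/-- The component `E(ω)` of `E` with `[H, E(ω)] = ħ ω E(ω)`: in an orthonormal eigenbasis of `H`,
keep the entries `⟨a|E|b⟩` with `ε_a - ε_b = ħ ω`. -/
def bohrComponent {H : Matrix m m ℂ} (hH : H.IsHermitian) (hbar ω : ℝ) (E : Matrix m m ℂ) :
    Matrix m m ℂ :=
  (hH.eigenvectorUnitary : Matrix m m ℂ) *
    (Matrix.of fun a b => if hH.eigenvalues a - hH.eigenvalues b = hbar * ω then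
      ((hH.eigenvectorUnitary : Matrix m m ℂ).conjTranspose * E *
        (hH.eigenvectorUnitary : Matrix m m ℂ)) a b else 0) *
    (hH.eigenvectorUnitary : Matrix m m ℂ).conjTranspose

open Classical in
/-- The Bohr frequencies `(ε_a - ε_b) / ħ` of `H`. -/
def bohrFrequencies {H : Matrix m m ℂ} (hH : H.IsHermitian) (hbar : ℝ) : Finset ℝ :=
  Finset.univ.image fun p : m × m => (hH.eigenvalues p.1 - hH.eigenvalues p.2) / hbar

/-- The generator
`-(i/ħ)[H,ρ] + ∑_ω ∑_{μ,ν} Γ_ω^{μν} (E_μ(ω) ρ E_ν(ω)† - ½ {E_ν(ω)† E_μ(ω), ρ})`. -/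
def lindblad {H : Matrix m m ℂ} (hH : H.IsHermitian) (hbar : ℝ) {κ : Type} [Fintype κ]
    (E : κ → Matrix m m ℂ) (Γ : ℝ → Matrix κ κ ℂ) (ρ : Matrix m m ℂ) : Matrix m m ℂ :=
  (-(Complex.I / (hbar : ℂ))) • (H * ρ - ρ * H) +
    ∑ ω ∈ bohrFrequencies hH hbar, ∑ μ, ∑ ν, Γ ω μ ν •
      (bohrComponent hH hbar ω (E μ) * ρ * (bohrComponent hH hbar ω (E ν)).conjTranspose -
        (1 / 2 : ℂ) •
          ((bohrComponent hH hbar ω (E ν)).conjTranspose * bohrComponent hH hbar ω (E μ) * ρ +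
            ρ * ((bohrComponent hH hbar ω (E ν)).conjTranspose *
              bohrComponent hH hbar ω (E μ))))

/-- Density matrices. -/
def IsDensity (ρ : Matrix m m ℂ) : Prop := ρ.PosSemidef ∧ ρ.trace = 1

end Lindblad

open Classical in
/-- Let `G` be a square matrix, `A` a set of (active) indices and `G_A` the block of `G` on `A`.
`G_A` has full rank over `P` if its range contains the coordinate vector of every index
in `A ∩ P`. If the nonzero entries of `G_A` all lie in the block on `A ∩ P`, this says that this
block is invertible. -/
def HasFullRankOver {κ : Type} [Fintype κ] (G : Matrix κ κ ℂ) (A P : Set κ) : Prop :=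
  ∀ μ : A, μ.1 ∈ P → ∃ x : A → ℂ,
    (G.submatrix (Subtype.val : A → κ) (Subtype.val : A → κ)).mulVec x = Pi.single μ 1

/-- The assumptions on the rates, for a set `R` of roots of `su(d)` and jump sources `E_μ`: at each
Bohr frequency `ω` the matrix `Γ_ω` is positive semidefinite, and over the roots `μ ∈ R ∪ (-R)`
with `E_μ(ω) ≠ 0` it has full rank. -/
def RatesFullRank {m : Type} [Fintype m] [DecidableEq m] {H : Matrix m m ℂ} (hH : H.IsHermitian)
    (hbar : ℝ) {d : ℕ} (E : SuRoot d → Matrix m m ℂ)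
    (Γ : ℝ → Matrix (SuRoot d) (SuRoot d) ℂ) (R : Finset (SuRoot d)) : Prop :=
  ∀ ω ∈ bohrFrequencies hH hbar,
    (Γ ω).PosSemidef ∧
    HasFullRankOver (Γ ω) {μ | bohrComponent hH hbar ω (E μ) ≠ 0} {μ | μ ∈ R ∨ μ.neg ∈ R}

/-! ## Schur bases -/

/-- The operators `Y a` on `ℂ^q` act irreducibly. -/
def IsIrreducibleFamily {κ : Type} {q : ℕ} (Y : κ → Matrix (Fin q) (Fin q) ℂ) : Prop :=
  0 < q ∧ ∀ W : Submodule ℂ (Fin q → ℂ),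
    (∀ a, ∀ v ∈ W, (Y a).mulVec v ∈ W) → W = ⊥ ∨ W = ⊤

/-- Two families of operators are equivalent: an invertible `T` intertwines them. -/
def AreEquivalentFamilies {κ : Type} {q r : ℕ} (Y : κ → Matrix (Fin q) (Fin q) ℂ)
    (Z : κ → Matrix (Fin r) (Fin r) ℂ) : Prop :=
  ∃ (T : Matrix (Fin r) (Fin q) ℂ) (T' : Matrix (Fin q) (Fin r) ℂ),
    T' * T = 1 ∧ T * T' = 1 ∧ ∀ a, T * Y a = Z a * T

/-- A Schur basis for the generators `X a`: an orthonormal basis (the columns of `U`) that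
identifies the Hilbert space with `⨁_l K^l ⊗ H^l`, with `K^l = ℂ^(mult l)`, `H^l = ℂ^(dim l)`, such
that `X a = ⨁_l 1 ⊗ X^l a`, where the `X^l` are irreducible and pairwise inequivalent. -/
structure SchurBasis {m : Type} [Fintype m] [DecidableEq m] {κ : Type} (X : κ → Matrix m m ℂ)
    (L : Type) [Fintype L] [DecidableEq L] where
  mult : L → ℕ
  dim : L → ℕ
  mult_pos : ∀ l, 0 < mult l
  U : Matrix m (Σ l : L, Fin (mult l) × Fin (dim l)) ℂ
  conjTranspose_mul : U.conjTranspose * U = 1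
  mul_conjTranspose : U * U.conjTranspose = 1
  irrep : ∀ l, κ → Matrix (Fin (dim l)) (Fin (dim l)) ℂ
  decomp : ∀ a, X a = U * Matrix.blockDiagonal' (fun l =>
    (1 : Matrix (Fin (mult l)) (Fin (mult l)) ℂ) ⊗ₖ irrep l a) * U.conjTranspose
  irreducible : ∀ l, IsIrreducibleFamily (irrep l)
  inequivalent : ∀ l l', l ≠ l' → ¬ AreEquivalentFamilies (irrep l) (irrep l')

namespace SchurBasis

variable {m : Type} [Fintype m] [DecidableEq m] {κ : Type} {X : κ → Matrix m m ℂ}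
  {L : Type} [Fintype L] [DecidableEq L] (S : SchurBasis X L)

/-- The operator `⨁_l A^l`, with `A^l` acting on `K^l ⊗ H^l`. -/
def directSum (A : ∀ l, Matrix (Fin (S.mult l) × Fin (S.dim l))
    (Fin (S.mult l) × Fin (S.dim l)) ℂ) : Matrix m m ℂ :=
  S.U * Matrix.blockDiagonal' A * S.U.conjTranspose

end SchurBasis

/-- The steady states of `G` have the universal form `⨁_l p^l σ^l ⊗ ρ^l`: a Schur basis for the
generators `X` exists and, in every Schur basis, there are fixed states `ρ^l` on the irreps
such that
* for each `l` and each state `σ` on `K^l`, the state `ρ^l` is the only state `θ` on `H^l` for which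
  `σ ⊗ θ`, placed in block `l`, is steady;
* the steady states are exactly the operators `⨁_l p^l σ^l ⊗ ρ^l` with arbitrary probabilities
  `p^l` and arbitrary states `σ^l` on `K^l`. -/
def SteadyStatesHaveSchurForm {m : Type} [Fintype m] [DecidableEq m] {κ : Type}
    (X : κ → Matrix m m ℂ) (G : Matrix m m ℂ → Matrix m m ℂ) : Prop :=
  (∃ r : ℕ, Nonempty (SchurBasis X (Fin r))) ∧
  ∀ (L : Type) [Fintype L] [DecidableEq L] (S : SchurBasis X L),
    ∃ ρ : ∀ l, Matrix (Fin (S.dim l)) (Fin (S.dim l)) ℂ,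
      (∀ l, IsDensity (ρ l)) ∧
      (∀ (l : L) (σ : Matrix (Fin (S.mult l)) (Fin (S.mult l)) ℂ)
          (θ : Matrix (Fin (S.dim l)) (Fin (S.dim l)) ℂ), IsDensity σ → IsDensity θ →
          (G (S.directSum (Pi.single l (σ ⊗ₖ θ))) = 0 ↔ θ = ρ l)) ∧
      ∀ η : Matrix m m ℂ, (IsDensity η ∧ G η = 0) ↔
        ∃ (p : L → ℝ) (σ : ∀ l, Matrix (Fin (S.mult l)) (Fin (S.mult l)) ℂ),
          (∀ l, 0 ≤ p l) ∧ ∑ l, p l = 1 ∧ (∀ l, IsDensity (σ l)) ∧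
          η = S.directSum fun l => (p l : ℂ) • (σ l ⊗ₖ ρ l)

end

/-!
A Schur basis exists by complete reducibility of Hermitian families and Schur's lemma
(`exists_schurBasis`). In such a basis, the operators that commute with the commutant of the
generators are exactly the `⨁_l 1 ⊗ B^l` (`SchurBasis.exists_eq_one_tensor_of_commutes`). The
Hamiltonian is of this kind because it is a polynomial in collective operators: for
permutation-invariant Hamiltonians this is the half of Schur–Weyl duality proved in
`IsPermutationInvariant.mem_adjoin`. So are the Bohr components `E_μ(ω)` and hence all jump
operators. The generator therefore acts on `A ⊗ B` in block `l` as `A ⊗ L^l(B)`, where `L^l` is a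
Lindblad generator on the irrep `H^l`.

The full-rank assumption makes `E_μ(ω)`, for `μ ∈ R ∪ (-R)`, a combination of jump operators
(`mem_span_jumpOperator`). Summing over `ω`, the algebra generated by the jump operators contains
`E_μ` for `μ ∈ R ∪ (-R)`, and these generate all collective operators
(`suGenerator_mem_adjoin`, `collective_spinXYZ_mem_adjoin`). In particular the jump operators act
irreducibly on each `H^l`.

On an irrep, the diagonal of `L^l(η) = 0` in an eigenbasis of a Hermitian `η` is a stationary
classical rate equation. It shows that the jump operators preserve the span of the eigenvectors of
`η` with positive eigenvalue, so by irreducibility a nonzero Hermitian stationary `η` is definite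
(`posDef_or_neg_posDef_of_gksl_eq_zero`). This yields a unique stationary state `ρ^l`, and
shows it to be positive definite. Finally `ρ₀ = ⨁_l 1 ⊗ ρ^l` is positive definite and stationary on
the whole space, and the dissipation identity (`gksl_dissipation`) shows that every stationary
operator is `X ρ₀` with `X` commuting with all jump operators (`exists_commuting_of_gksl_eq_zero`),
so with all generators. By Schur's lemma `X = ⨁_l A^l ⊗ 1`, so that every stationary operator is
`⨁_l A^l ⊗ ρ^l`; in particular there are no coherences between inequivalent irreps.
-/

noncomputable section

/-! ### Collective operators -/

/-- The product operator `F 0 ⊗ ⋯ ⊗ F (n - 1)` on `(ℂ^d)^{⊗ n}`, as a monoid homomorphism. -/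
def siteProduct {n d : ℕ} : (Fin n → Matrix (Fin d) (Fin d) ℂ) →*
    Matrix (Fin n → Fin d) (Fin n → Fin d) ℂ where
  toFun F := Matrix.of fun i j => ∏ l, F l (i l) (j l)
  map_one' := by
    ext i j
    by_cases h : i = j
    · subst h; simp
    · obtain ⟨l, hl⟩ := Function.ne_iff.mp h
      simp only [Matrix.of_apply, Pi.one_apply, Matrix.one_apply_ne h]
      exact Finset.prod_eq_zero (Finset.mem_univ l) (Matrix.one_apply_ne hl)
  map_mul' F G := by
    ext i j
    simp only [Matrix.of_apply, Pi.mul_apply, Matrix.mul_apply, Finset.prod_univ_sum,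
      Fintype.piFinset_univ, Finset.prod_mul_distrib]

theorem siteProduct_apply {n d : ℕ} (F : Fin n → Matrix (Fin d) (Fin d) ℂ) (i j : Fin n → Fin d) :
    siteProduct F i j = ∏ l, F l (i l) (j l) := rfl

theorem siteProduct_conjTranspose {n d : ℕ} (F : Fin n → Matrix (Fin d) (Fin d) ℂ) :
    (siteProduct F).conjTranspose = siteProduct fun l => (F l).conjTranspose := by
  ext i j
  simp [siteProduct_apply]

theorem collective_eq_sum {n d : ℕ} (x : Matrix (Fin d) (Fin d) ℂ) :
    collective n x = ∑ k, siteProduct (Pi.mulSingle k x) := by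
  ext i j
  simp only [collective, Matrix.of_apply, Matrix.sum_apply, siteProduct_apply]
  refine Finset.sum_congr rfl fun k _ => ?_
  rw [← Finset.mul_prod_erase _ _ (Finset.mem_univ k), Pi.mulSingle_eq_same]
  congr 1
  refine Finset.prod_congr rfl fun l hl => ?_
  rw [Pi.mulSingle_eq_of_ne (Finset.ne_of_mem_erase hl)]

theorem collective_one {n d : ℕ} :
    collective n (1 : Matrix (Fin d) (Fin d) ℂ) = (n : ℂ) • 1 := by
  simp [collective_eq_sum, Nat.cast_smul_eq_nsmul]

/-- `collective n` as a linear map. -/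
def collectiveHom (n d : ℕ) : Matrix (Fin d) (Fin d) ℂ →ₗ[ℂ]
    Matrix (Fin n → Fin d) (Fin n → Fin d) ℂ where
  toFun := collective n
  map_add' x y := by
    ext i j
    simp [collective, add_mul, Finset.sum_add_distrib]
  map_smul' c x := by
    ext i j
    simp [collective, Finset.mul_sum, mul_assoc]

theorem collectiveHom_apply {n d : ℕ} (x : Matrix (Fin d) (Fin d) ℂ) :
    collectiveHom n d x = collective n x := rfl

theorem collective_conjTranspose {n d : ℕ} (x : Matrix (Fin d) (Fin d) ℂ) :
    (collective n x).conjTranspose = collective n x.conjTranspose := by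
  simp only [collective_eq_sum, Matrix.conjTranspose_sum, siteProduct_conjTranspose]
  refine Finset.sum_congr rfl fun k _ => congrArg _ (funext fun l => ?_)
  by_cases h : l = k
  · subst h; simp
  · simp [Pi.mulSingle_eq_of_ne h]

theorem collective_commutator {n d : ℕ} (x y : Matrix (Fin d) (Fin d) ℂ) :
    collective n x * collective n y - collective n y * collective n x =
      collective n (x * y - y * x) := by
  rw [← collectiveHom_apply (x * y - y * x), map_sub, collectiveHom_apply, collectiveHom_apply]
  simp only [collective_eq_sum, Finset.sum_mul_sum]
  rw [Finset.sum_comm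
      (f := fun i j => siteProduct (Pi.mulSingle i y) * siteProduct (Pi.mulSingle j x)),
    ← Finset.sum_sub_distrib, ← Finset.sum_sub_distrib]
  refine Finset.sum_congr rfl fun k _ => ?_
  rw [← Finset.sum_sub_distrib, Finset.sum_eq_single k]
  · simp only [← map_mul, Pi.mulSingle_mul]
  · intro l _ hl
    rw [← map_mul, ← map_mul, (Pi.mulSingle_commute
      (f := fun _ : Fin n => Matrix (Fin d) (Fin d) ℂ) hl y x).eq, sub_self]
  · simp

/-! ### Permutation-invariant operators -/

/-- The sum of the product operators `F (π 0) ⊗ ⋯ ⊗ F (π (n - 1))` over all permutations `π`. -/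
def symmetrization {n d : ℕ} (F : Fin n → Matrix (Fin d) (Fin d) ℂ) :
    Matrix (Fin n → Fin d) (Fin n → Fin d) ℂ :=
  ∑ π : Equiv.Perm (Fin n), siteProduct (F ∘ π)

theorem symmetrization_comp {n d : ℕ} (F : Fin n → Matrix (Fin d) (Fin d) ℂ)
    (τ : Equiv.Perm (Fin n)) : symmetrization (F ∘ τ) = symmetrization F :=
  Fintype.sum_equiv (Equiv.mulLeft τ) _ _ fun _ => rfl

theorem symmetrization_mul_collective {n d : ℕ} (F : Fin n → Matrix (Fin d) (Fin d) ℂ)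
    (y : Matrix (Fin d) (Fin d) ℂ) :
    symmetrization F * collective n y =
      ∑ k, symmetrization (Function.update F k (F k * y)) := by
  simp only [symmetrization, collective_eq_sum, Finset.sum_mul]
  rw [Finset.sum_comm]
  refine Finset.sum_congr rfl fun π _ => ?_
  rw [Finset.mul_sum]
  refine Fintype.sum_equiv π _ _ fun k => ?_
  rw [← map_mul]
  congr 1
  funext l
  by_cases h : l = k
  · subst h; simp
  · simp [h]

/-- Every symmetrized product lies in the algebra of the collective operators: if `F k₀ ≠ 1`, let
`F'` be `F` with `F k₀` replaced by `1`. Then `symmetrization F' * collective n (F k₀)` is a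
positive multiple of `symmetrization F` plus symmetrized products with fewer nontrivial factors. -/
theorem symmetrization_mem_adjoin {n d : ℕ} (F : Fin n → Matrix (Fin d) (Fin d) ℂ) :
    symmetrization F ∈ Algebra.adjoin ℂ (Set.range (collective n (d := d))) := by
  classical
  induction h : (Finset.univ.filter fun k => F k ≠ 1).card using Nat.strong_induction_on
    generalizing F with
  | _ r ih =>
    set A := Algebra.adjoin ℂ (Set.range (collective n (d := d)))
    by_cases hF : ∀ k, F k = 1
    · obtain rfl : F = 1 := funext hF
      have : symmetrization (1 : Fin n → Matrix (Fin d) (Fin d) ℂ) =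
          ∑ _π : Equiv.Perm (Fin n), 1 :=
        Finset.sum_congr rfl fun π _ => by
          rw [show (1 : Fin n → Matrix (Fin d) (Fin d) ℂ) ∘ π = 1 from rfl, map_one]
      rw [this]
      exact sum_mem fun _ _ => one_mem _
    push Not at hF
    obtain ⟨k₀, hk₀⟩ := hF
    set F' := Function.update F k₀ 1 with hF'
    have hcard : ∀ F'' : Fin n → Matrix (Fin d) (Fin d) ℂ, (∀ k, F'' k ≠ 1 → k ≠ k₀ ∧ F k ≠ 1) →
        symmetrization F'' ∈ A := by
      intro F'' hF''
      refine ih _ ?_ F'' rfl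
      rw [← h]
      refine Finset.card_lt_card ⟨fun k hk => ?_, fun hk => ?_⟩
      · simp only [Finset.mem_filter_univ] at hk ⊢
        exact (hF'' k hk).2
      · have := hk (Finset.mem_filter.2 ⟨Finset.mem_univ k₀, hk₀⟩)
        simp only [Finset.mem_filter_univ] at this
        exact (hF'' k₀ this).1 rfl
    have hmul := symmetrization_mul_collective F' (F k₀)
    -- inserting `F k₀` at any idle site gives `F` up to a transposition
    have hsame : ∀ k ∈ Finset.univ.filter fun k => F' k = 1,
        symmetrization (Function.update F' k (F' k * F k₀)) = symmetrization F := by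
      intro k hk
      rw [Finset.mem_filter_univ] at hk
      rw [hk, one_mul, ← symmetrization_comp F (Equiv.swap k k₀)]
      congr 1
      funext l
      by_cases h1 : l = k
      · subst h1; simp
      · by_cases h2 : l = k₀
        · subst h2
          have : k ≠ l := fun h => h1 h.symm
          simp only [hF', Function.update_of_ne this] at hk
          simp [h1, hF', hk]
        · simp [h1, h2, hF', Equiv.swap_apply_of_ne_of_ne h1 h2]
    rw [← Finset.sum_filter_add_sum_filter_not _ (fun k => F' k = 1), Finset.sum_congr rfl hsame,
      Finset.sum_const] at hmul
    have hpos : (Finset.univ.filter fun k => F' k = 1).card ≠ 0 :=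
      Finset.card_ne_zero_of_mem (a := k₀) (by simp [hF'])
    have hmem : symmetrization F' * collective n (F k₀) -
        ∑ k with ¬ F' k = 1, symmetrization (Function.update F' k (F' k * F k₀)) ∈ A := by
      refine sub_mem (mul_mem (hcard F' fun k hk => ?_)
        (Algebra.subset_adjoin ⟨_, rfl⟩)) (sum_mem fun k hk => hcard _ fun l hl => ?_)
      · by_cases h1 : k = k₀
        · subst h1; simp [hF'] at hk
        · exact ⟨h1, by simpa [hF', h1] using hk⟩
      · rw [Finset.mem_filter_univ] at hk
        have hkk : k ≠ k₀ := by rintro rfl; simp [hF'] at hk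
        by_cases h1 : l = k₀
        · subst h1
          simp [hF', hkk.symm] at hl
        · refine ⟨h1, ?_⟩
          by_cases h2 : l = k
          · subst h2; simpa [hF', h1] using hk
          · simpa [hF', h1, h2] using hl
    rw [hmul, add_sub_cancel_right, ← Nat.cast_smul_eq_nsmul ℂ] at hmem
    have := A.smul_mem hmem (((Finset.univ.filter fun k => F' k = 1).card : ℂ)⁻¹)
    rwa [smul_smul, inv_mul_cancel₀ (Nat.cast_ne_zero.2 hpos), one_smul] at this

/-- The half of Schur–Weyl duality that is needed: a permutation-invariant operator is a polynomial
in collective operators, since averaging its matrix-unit expansion over the permutations expresses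
it through symmetrized products. -/
theorem IsPermutationInvariant.mem_adjoin {n d : ℕ}
    {O : Matrix (Fin n → Fin d) (Fin n → Fin d) ℂ} (hO : IsPermutationInvariant O) :
    O ∈ Algebra.adjoin ℂ (Set.range (collective n (d := d))) := by
  set A := Algebra.adjoin ℂ (Set.range (collective n (d := d)))
  have hsum : (Fintype.card (Equiv.Perm (Fin n)) : ℂ) • O =
      ∑ i, ∑ j, O i j • symmetrization fun l => Matrix.single (i l) (j l) (1 : ℂ) := by
    have key : ∀ π : Equiv.Perm (Fin n), O = ∑ i, ∑ j,
        O i j • siteProduct ((fun l => Matrix.single (i l) (j l) (1 : ℂ)) ∘ π) := by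
      intro π
      have hs : ∀ i j : Fin n → Fin d,
          siteProduct ((fun l => Matrix.single (i l) (j l) (1 : ℂ)) ∘ π) =
          Matrix.single (i ∘ π) (j ∘ π) 1 := by
        intro i j
        ext a b
        rw [siteProduct_apply]
        by_cases h : i ∘ π = a ∧ j ∘ π = b
        · obtain ⟨rfl, rfl⟩ := h
          simp
        · rw [Matrix.single_apply, if_neg h]
          have : ∃ l, ¬ (i (π l) = a l ∧ j (π l) = b l) := by
            by_contra! hc
            exact h ⟨funext fun l => (hc l).1, funext fun l => (hc l).2⟩
          obtain ⟨l, hl⟩ := this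
          exact Finset.prod_eq_zero (Finset.mem_univ l)
            (by rw [Function.comp_apply, Matrix.single_apply, if_neg hl])
      simp only [hs]
      conv_lhs => rw [Matrix.matrix_eq_sum_single O]
      refine (Fintype.sum_equiv (Equiv.arrowCongr π.symm (Equiv.refl _)) _ _ fun i => ?_).symm
      refine (Fintype.sum_equiv (Equiv.arrowCongr π.symm (Equiv.refl _)) _ _ fun j => ?_)
      have := hO π i j
      have hcomp : ∀ f, Equiv.arrowCongr π.symm (Equiv.refl (Fin d)) f = f ∘ π := fun f => rfl
      rw [hcomp, hcomp, this, Matrix.smul_single, smul_eq_mul, mul_one]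
    simp only [symmetrization, Finset.smul_sum]
    rw [Finset.sum_congr rfl fun i _ => Finset.sum_comm, Finset.sum_comm,
      ← Finset.sum_congr rfl fun π _ => key π]
    simp [Nat.cast_smul_eq_nsmul]
  have hmem : (Fintype.card (Equiv.Perm (Fin n)) : ℂ) • O ∈ A := by
    rw [hsum]
    exact sum_mem fun i _ => sum_mem fun j _ => A.smul_mem (symmetrization_mem_adjoin _) _
  have := A.smul_mem hmem ((Fintype.card (Equiv.Perm (Fin n)) : ℂ)⁻¹)
  rwa [smul_smul, inv_mul_cancel₀ (Nat.cast_ne_zero.2 Fintype.card_ne_zero), one_smul] at this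

/-! ### Generation by root vectors -/

/-- Every `x` is a complex combination of traceless Hermitian matrices and `1`, and `1` is
represented by the scalar `n`. -/
theorem collective_mem_adjoin_suGenerator {n d : ℕ} (x : Matrix (Fin d) (Fin d) ℂ) :
    collective n x ∈ Algebra.adjoin ℂ (Set.range fun y : SuGenerator d => collective n y.1) := by
  set A := Algebra.adjoin ℂ (Set.range fun y : SuGenerator d => collective n y.1)
  have herm : ∀ h : Matrix (Fin d) (Fin d) ℂ, h.IsHermitian → collective n h ∈ A := by
    intro h hh
    rcases Nat.eq_zero_or_pos d with rfl | hd
    · exact Algebra.subset_adjoin ⟨⟨h, hh, by simp [Matrix.trace]⟩, rfl⟩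
    have hd' : (d : ℂ) ≠ 0 := Nat.cast_ne_zero.2 hd.ne'
    set c : ℂ := h.trace / d with hc
    have hcs : star c = c := by
      have : star h.trace = h.trace := by rw [← Matrix.trace_conjTranspose, hh.eq]
      rw [hc, star_div₀, this, star_natCast]
    have hmem : collective n (h - c • 1) ∈ A := by
      refine Algebra.subset_adjoin ⟨⟨h - c • 1, ?_, ?_⟩, rfl⟩
      · rw [Matrix.IsHermitian, Matrix.conjTranspose_sub, Matrix.conjTranspose_smul, hh.eq, hcs,
          Matrix.conjTranspose_one]
      · rw [Matrix.trace_sub, Matrix.trace_smul, Matrix.trace_one, Fintype.card_fin, hc,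
          smul_eq_mul, div_mul_cancel₀ _ hd', sub_self]
    have h1 : collective n (c • (1 : Matrix (Fin d) (Fin d) ℂ)) ∈ A := by
      rw [← collectiveHom_apply, map_smul, collectiveHom_apply, collective_one]
      exact A.smul_mem (A.smul_mem (one_mem _) _) _
    have := add_mem hmem h1
    rwa [← collectiveHom_apply, ← collectiveHom_apply, ← map_add, sub_add_cancel] at this
  have hx : x = (1 / 2 : ℂ) • (x + x.conjTranspose) +
      (-Complex.I / 2) • (Complex.I • (x - x.conjTranspose)) := by
    rw [smul_smul, show -Complex.I / 2 * Complex.I = 1 / 2 by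
      rw [div_mul_eq_mul_div, neg_mul, Complex.I_mul_I, neg_neg], ← smul_add]
    rw [show x + x.conjTranspose + (x - x.conjTranspose) = (2 : ℂ) • x by
      rw [two_smul]; abel, smul_smul]
    norm_num
  rw [hx, ← collectiveHom_apply, map_add, map_smul, map_smul]
  refine add_mem (A.smul_mem (herm _ ?_) _) (A.smul_mem (herm _ ?_) _)
  · rw [Matrix.IsHermitian, Matrix.conjTranspose_add, Matrix.conjTranspose_conjTranspose, add_comm]
  · rw [Matrix.IsHermitian, Matrix.conjTranspose_smul, Matrix.conjTranspose_sub,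
      Matrix.conjTranspose_conjTranspose, Complex.star_def, Complex.conj_I, neg_smul, ← smul_neg,
      neg_sub]

/-- The root vectors for `±R` generate all root vectors. Call `i` and `j` related if `|i⟩⟨j|` and
`|j⟩⟨i|` are both represented in the algebra; commutators make this an equivalence relation. Were
the endpoints of some root `ν` unrelated, the indicator functional of the class of one of them
would vanish on `R` but not on `ν`, although `ν` is a combination of `R`. -/
theorem collective_single_mem_adjoin {n d : ℕ} {c : SuRoot d → ℂ} (hc : ∀ μ, c μ ≠ 0)
    {R : Finset (SuRoot d)} (hR : IsSimpleRoots R) (ν : SuRoot d) :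
    collective n (Matrix.single ν.1.1 ν.1.2 1) ∈ Algebra.adjoin ℂ
      ((fun μ : SuRoot d => collective n (μ.gen (c μ))) '' {μ | μ ∈ R ∨ μ.neg ∈ R}) := by
  classical
  set B := Algebra.adjoin ℂ
      ((fun μ : SuRoot d => collective n (μ.gen (c μ))) '' {μ | μ ∈ R ∨ μ.neg ∈ R})
  let r : Fin d → Fin d → Prop := fun i j => i = j ∨
    (collective n (Matrix.single i j 1) ∈ B ∧ collective n (Matrix.single j i 1) ∈ B)
  have hmulmem : ∀ i j k : Fin d, i ≠ k → collective n (Matrix.single i j 1) ∈ B →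
      collective n (Matrix.single j k 1) ∈ B → collective n (Matrix.single i k 1) ∈ B := by
    intro i j k hik h1 h2
    have := sub_mem (mul_mem h1 h2) (mul_mem h2 h1)
    rw [collective_commutator, Matrix.single_mul_single_same, mul_one,
      Matrix.single_mul_single_of_ne _ _ _ _ hik.symm, sub_zero] at this
    exact this
  have hsymm : ∀ i j, r i j → r j i := fun i j h => h.imp Eq.symm And.symm
  have htrans : ∀ i j k, r i j → r j k → r i k := by
    intro i j k h1 h2
    by_cases hik : i = k
    · exact Or.inl hik
    rcases h1 with rfl | h1
    · exact h2
    rcases h2 with rfl | h2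
    · exact Or.inr h1
    exact Or.inr ⟨hmulmem i j k hik h1.1 h2.1, hmulmem k j i (Ne.symm hik) h2.2 h1.2⟩
  have hmem : ∀ μ : SuRoot d, (μ ∈ R ∨ μ.neg ∈ R) →
      collective n (Matrix.single μ.1.1 μ.1.2 1) ∈ B := by
    intro μ hμ
    have h1 : collective n (μ.gen (c μ)) ∈ B := Algebra.subset_adjoin ⟨μ, hμ, rfl⟩
    have h2 := B.smul_mem h1 (c μ)⁻¹
    rw [← collectiveHom_apply, ← map_smul, SuRoot.gen, Matrix.smul_single, smul_eq_mul,
      inv_mul_cancel₀ (hc μ)] at h2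
    exact h2
  have hRr : ∀ μ ∈ R, r μ.1.1 μ.1.2 := fun μ hμ =>
    Or.inr ⟨hmem μ (Or.inl hμ), hmem μ.neg (Or.inr hμ)⟩
  suffices h : r ν.1.1 ν.1.2 from (h.resolve_left ν.2).1
  by_contra hcon
  obtain ⟨a, -, ha⟩ := hR.2 ν
  -- the sum of the coordinates in the class of the first endpoint of `ν`
  let χ : (Fin d → ℝ) →ₗ[ℝ] ℝ := ∑ k with r ν.1.1 k, LinearMap.proj k
  have hχ : ∀ μ : SuRoot d, χ μ.vec =
      (if r ν.1.1 μ.1.1 then 1 else 0) - (if r ν.1.1 μ.1.2 then 1 else 0) := by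
    intro μ
    simp [χ, SuRoot.vec, Finset.sum_sub_distrib, Pi.single_apply]
  have h0 : χ ν.vec = 0 := by
    rw [ha, map_sum]
    refine Finset.sum_eq_zero fun μ hμ => ?_
    have : r ν.1.1 μ.1.1 ↔ r ν.1.1 μ.1.2 :=
      ⟨fun h => htrans _ _ _ h (hRr μ hμ), fun h => htrans _ _ _ h (hsymm _ _ (hRr μ hμ))⟩
    rw [map_smul, hχ]
    simp [this]
  rw [hχ, if_pos (Or.inl rfl), if_neg hcon] at h0
  norm_num at h0

theorem suGenerator_mem_adjoin {n d : ℕ} {c : SuRoot d → ℂ} (hc : ∀ μ, c μ ≠ 0)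
    {R : Finset (SuRoot d)} (hR : IsSimpleRoots R) (x : SuGenerator d) :
    collective n x.1 ∈ Algebra.adjoin ℂ
      ((fun μ : SuRoot d => collective n (μ.gen (c μ))) '' {μ | μ ∈ R ∨ μ.neg ∈ R}) := by
  classical
  set B := Algebra.adjoin ℂ
      ((fun μ : SuRoot d => collective n (μ.gen (c μ))) '' {μ | μ ∈ R ∨ μ.neg ∈ R})
  have hoff : ∀ i j : Fin d, i ≠ j → collective n (Matrix.single i j 1) ∈ B := fun i j hij =>
    collective_single_mem_adjoin hc hR ⟨(i, j), hij⟩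
  have hdiag : ∀ i j : Fin d, collective n (Matrix.single i i 1 - Matrix.single j j 1) ∈ B := by
    intro i j
    by_cases hij : i = j
    · subst hij
      rw [sub_self, ← collectiveHom_apply, map_zero]
      exact zero_mem _
    · have := sub_mem (mul_mem (hoff i j hij) (hoff j i (Ne.symm hij)))
        (mul_mem (hoff j i (Ne.symm hij)) (hoff i j hij))
      rwa [collective_commutator, Matrix.single_mul_single_same, Matrix.single_mul_single_same,
        mul_one] at this
  rcases Nat.eq_zero_or_pos d with rfl | hd
  · have : x.1 = 0 := Subsingleton.elim _ _
    rw [this, ← collectiveHom_apply, map_zero]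
    exact zero_mem _
  let o : Fin d := ⟨0, hd⟩
  have hx : x.1 = ∑ i, ∑ j, x.1 i j • (Matrix.single i j 1 -
      if i = j then Matrix.single o o (1 : ℂ) else 0) := by
    have htr : ∑ i, x.1 i i = 0 := x.2.2
    simp only [smul_sub, Finset.sum_sub_distrib, smul_ite, smul_zero, Finset.sum_ite_eq,
      Finset.mem_univ, if_true, ← Finset.sum_smul, htr, zero_smul, sub_zero]
    conv_lhs => rw [Matrix.matrix_eq_sum_single x.1]
    simp [Matrix.smul_single]
  rw [hx, ← collectiveHom_apply, map_sum]
  refine sum_mem fun i _ => ?_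
  rw [map_sum]
  refine sum_mem fun j _ => ?_
  rw [map_smul, collectiveHom_apply]
  refine B.smul_mem ?_ _
  by_cases hij : i = j
  · subst hij
    rw [if_pos rfl]
    exact hdiag i o
  · rw [if_neg hij, sub_zero]
    exact hoff i j hij

/-! ### Spin operators -/

theorem mem_or_neg_mem_of_isSimpleRoots {R : Finset (SuRoot 2)} (hR : IsSimpleRoots R)
    (μ : SuRoot 2) : μ ∈ R ∨ μ.neg ∈ R := by
  have hne : R.Nonempty := by
    by_contra h
    rw [Finset.not_nonempty_iff_eq_empty] at h
    obtain ⟨c, -, hc⟩ := hR.2 μ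
    rw [h, Finset.sum_empty] at hc
    have := congrFun hc μ.1.1
    simp [SuRoot.vec, μ.2] at this
  obtain ⟨ν, hν⟩ := hne
  have : μ = ν ∨ μ.neg = ν := by
    revert μ ν
    simp only [Subtype.forall, Prod.forall, SuRoot.neg, Subtype.mk.injEq, Prod.mk.injEq]
    intro a b hab c d hcd _
    omega
  rcases this with rfl | rfl
  · exact Or.inl hν
  · exact Or.inr hν

/-- The squared ladder coefficient, in factored form `(s - m) (s + m + 1)`. -/
theorem spinPlus_apply_succ {N : ℕ} (a b : Fin (N + 1)) (h : (a : ℕ) + 1 = b) :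
    spinPlus N a b * star (spinPlus N a b) = ((a : ℕ) + 1) * (N - (a : ℕ) : ℂ) := by
  have hb : (b : ℝ) = a + 1 := by exact_mod_cast h.symm
  have ha : (a : ℝ) + 1 ≤ N := by
    have := b.2
    have : (a : ℕ) + 1 ≤ N := by omega
    exact_mod_cast this
  have heq : (N / 2 : ℝ) * (N / 2 + 1) - (N / 2 - b) * (N / 2 - b + 1) = (a + 1) * (N - a) := by
    rw [hb]; ring
  have hnn : (0 : ℝ) ≤ (a + 1) * (N - a) := by
    have : (0 : ℝ) ≤ a := Nat.cast_nonneg _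
    nlinarith
  simp only [spinPlus, Matrix.of_apply, if_pos h, heq, Complex.star_def, Complex.conj_ofReal,
    ← Complex.ofReal_mul, Real.mul_self_sqrt hnn]
  push_cast
  ring

theorem spinPlus_apply_of_ne {N : ℕ} (a b : Fin (N + 1)) (h : (a : ℕ) + 1 ≠ b) :
    spinPlus N a b = 0 := by
  simp [spinPlus, h]

theorem spinPlus_spinMinus_commutator (N : ℕ) :
    spinPlus N * spinMinus N - spinMinus N * spinPlus N = (2 : ℂ) • spinXYZ N 2 := by
  have h1 : spinPlus N * spinMinus N =
      Matrix.diagonal fun a : Fin (N + 1) => ((a : ℕ) + 1) * (N - (a : ℕ) : ℂ) := by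
    ext a b
    rw [Matrix.mul_apply, Matrix.diagonal_apply]
    simp only [spinMinus, Matrix.conjTranspose_apply]
    split_ifs with hab
    · subst hab
      by_cases ha : (a : ℕ) + 1 < N + 1
      · rw [Finset.sum_eq_single ⟨a + 1, ha⟩]
        · exact spinPlus_apply_succ _ _ rfl
        · intro c _ hc
          rw [spinPlus_apply_of_ne _ _ fun h => hc (Fin.ext h.symm), zero_mul]
        · simp
      · have : (N : ℂ) = (a : ℕ) := by
          have := a.2
          have : N = a := by omega
          exact_mod_cast this
        rw [this, sub_self, mul_zero]
        refine Finset.sum_eq_zero fun c _ => ?_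
        rw [spinPlus_apply_of_ne _ _ (by omega), zero_mul]
    · refine Finset.sum_eq_zero fun c _ => ?_
      by_cases h : (a : ℕ) + 1 = c
      · rw [spinPlus_apply_of_ne b c fun h' => hab (Fin.ext (by omega)), star_zero, mul_zero]
      · rw [spinPlus_apply_of_ne a c h, zero_mul]
  have h2 : spinMinus N * spinPlus N =
      Matrix.diagonal fun a : Fin (N + 1) => ((a : ℕ) : ℂ) * (N - (a : ℕ) + 1 : ℂ) := by
    ext a b
    rw [Matrix.mul_apply, Matrix.diagonal_apply]
    simp only [spinMinus, Matrix.conjTranspose_apply]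
    split_ifs with hab
    · subst hab
      by_cases ha : (a : ℕ) = 0
      · rw [ha, Nat.cast_zero, zero_mul]
        refine Finset.sum_eq_zero fun c _ => ?_
        rw [spinPlus_apply_of_ne c a (by omega), mul_zero]
      · have hlt : (a : ℕ) - 1 < N + 1 := by omega
        have hsucc : (a : ℕ) - 1 + 1 = a := by omega
        rw [Finset.sum_eq_single ⟨a - 1, hlt⟩]
        · rw [mul_comm, spinPlus_apply_succ _ _ hsucc]
          have : (((a : ℕ) - 1 : ℕ) : ℂ) = (a : ℕ) - 1 := by
            rw [Nat.cast_sub (by omega), Nat.cast_one]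
          simp only [this]
          ring
        · intro c _ hc
          rw [spinPlus_apply_of_ne c a fun h => hc (Fin.ext (by simp; omega)), mul_zero]
        · simp
    · refine Finset.sum_eq_zero fun c _ => ?_
      by_cases h : (c : ℕ) + 1 = b
      · rw [spinPlus_apply_of_ne c a fun h' => hab (Fin.ext (by omega)), star_zero, zero_mul]
      · rw [spinPlus_apply_of_ne c b h, mul_zero]
  have h3 : spinXYZ N 2 = Matrix.diagonal fun a : Fin (N + 1) => (N / 2 - (a : ℕ) : ℂ) := rfl
  rw [h1, h2, h3, Matrix.diagonal_sub, ← Matrix.diagonal_smul]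
  congr 1
  funext a
  simp only [Pi.smul_apply, smul_eq_mul]
  ring

theorem collective_spinXYZ_mem_adjoin {n N : ℕ} {R : Finset (SuRoot 2)} (hR : IsSimpleRoots R)
    (a : Fin 3) : collective n (spinXYZ N a) ∈ Algebra.adjoin ℂ
      ((fun μ => collective n (spinLadder N μ)) '' {μ | μ ∈ R ∨ μ.neg ∈ R}) := by
  set B := Algebra.adjoin ℂ
      ((fun μ => collective n (spinLadder N μ)) '' {μ | μ ∈ R ∨ μ.neg ∈ R})
  have hp : collective n (spinPlus N) ∈ B := Algebra.subset_adjoin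
    ⟨⟨(0, 1), by decide⟩, mem_or_neg_mem_of_isSimpleRoots hR _, by simp [spinLadder]⟩
  have hm : collective n (spinMinus N) ∈ B := Algebra.subset_adjoin
    ⟨⟨(1, 0), by decide⟩, mem_or_neg_mem_of_isSimpleRoots hR _, by simp [spinLadder]⟩
  have hz : collective n (spinXYZ N 2) ∈ B := by
    have := B.smul_mem (sub_mem (mul_mem hp hm) (mul_mem hm hp)) (2⁻¹ : ℂ)
    rwa [collective_commutator, spinPlus_spinMinus_commutator, ← collectiveHom_apply, ← map_smul,
      smul_smul, inv_mul_cancel₀ two_ne_zero, one_smul] at this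
  rw [← collectiveHom_apply] at hp hm
  fin_cases a
  · rw [← collectiveHom_apply]
    simp only [spinXYZ, Fin.zero_eta, Matrix.cons_val_zero, map_smul, map_add]
    exact B.smul_mem (add_mem hp hm) _
  · rw [← collectiveHom_apply]
    simp only [spinXYZ, Fin.mk_one, Matrix.cons_val_one, Matrix.cons_val_zero, map_smul, map_sub]
    exact B.smul_mem (sub_mem hp hm) _
  · exact hz

theorem collective_spinLadder_mem_adjoin {n N : ℕ} (μ : SuRoot 2) :
    collective n (spinLadder N μ) ∈
      Algebra.adjoin ℂ (Set.range fun a => collective n (spinXYZ N a)) := by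
  set A := Algebra.adjoin ℂ (Set.range fun a => collective n (spinXYZ N a))
  have h0 : collective n (spinXYZ N 0) ∈ A := Algebra.subset_adjoin ⟨0, rfl⟩
  have h1 : collective n (spinXYZ N 1) ∈ A := Algebra.subset_adjoin ⟨1, rfl⟩
  have e0 : spinXYZ N 0 = (1 / 2 : ℂ) • (spinPlus N + spinMinus N) := rfl
  have e1 : spinXYZ N 1 = (1 / (2 * Complex.I) : ℂ) • (spinPlus N - spinMinus N) := rfl
  have hI : Complex.I * (1 / (2 * Complex.I)) = 1 / 2 := by
    field_simp
  rw [← collectiveHom_apply] at h0 h1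
  unfold spinLadder
  split_ifs
  · have : spinPlus N = spinXYZ N 0 + Complex.I • spinXYZ N 1 := by
      rw [e0, e1, smul_smul, hI]
      module
    rw [this, ← collectiveHom_apply, map_add, map_smul]
    exact add_mem h0 (A.smul_mem h1 _)
  · have : spinMinus N = spinXYZ N 0 - Complex.I • spinXYZ N 1 := by
      rw [e0, e1, smul_smul, hI]
      module
    rw [this, ← collectiveHom_apply, map_sub, map_smul]
    exact sub_mem h0 (A.smul_mem h1 _)

theorem spinXYZ_isHermitian (N : ℕ) (a : Fin 3) : (spinXYZ N a).IsHermitian := by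
  fin_cases a
  · simp only [spinXYZ, Fin.zero_eta, Matrix.cons_val_zero, Matrix.IsHermitian,
      Matrix.conjTranspose_smul, Matrix.conjTranspose_add, spinMinus,
      Matrix.conjTranspose_conjTranspose]
    rw [add_comm (spinPlus N).conjTranspose]
    simp
  · simp only [spinXYZ, Fin.mk_one, Matrix.cons_val_one, Matrix.cons_val_zero, Matrix.IsHermitian,
      Matrix.conjTranspose_smul, Matrix.conjTranspose_sub, spinMinus,
      Matrix.conjTranspose_conjTranspose]
    rw [← neg_sub (spinPlus N), smul_neg, ← neg_smul]
    congr 1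
    simp
  · refine Matrix.isHermitian_diagonal_of_self_adjoint _ ?_
    ext a
    simp

/-! ### Schur's lemma -/

section Schur

variable {κ : Type} {q r : ℕ} {Y : κ → Matrix (Fin q) (Fin q) ℂ} {Z : κ → Matrix (Fin r) (Fin r) ℂ}

theorem AreEquivalentFamilies.refl (Y : κ → Matrix (Fin q) (Fin q) ℂ) :
    AreEquivalentFamilies Y Y :=
  ⟨1, 1, by simp, by simp, by simp⟩

theorem AreEquivalentFamilies.symm (h : AreEquivalentFamilies Y Z) :
    AreEquivalentFamilies Z Y := by
  obtain ⟨T, T', h1, h2, h3⟩ := h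
  refine ⟨T', T, h2, h1, fun a => ?_⟩
  calc T' * Z a = T' * (Z a * T) * T' := by
        rw [Matrix.mul_assoc, Matrix.mul_assoc, h2, Matrix.mul_one]
    _ = Y a * T' := by rw [← h3, ← Matrix.mul_assoc T', h1, Matrix.one_mul]

theorem AreEquivalentFamilies.trans {s : ℕ} {Z' : κ → Matrix (Fin s) (Fin s) ℂ}
    (h : AreEquivalentFamilies Y Z) (h' : AreEquivalentFamilies Z Z') :
    AreEquivalentFamilies Y Z' := by
  obtain ⟨T, T', h1, h2, h3⟩ := h
  obtain ⟨S, S', k1, k2, k3⟩ := h'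
  refine ⟨S * T, T' * S', ?_, ?_, fun a => ?_⟩
  · rw [Matrix.mul_assoc, ← Matrix.mul_assoc S', k1, Matrix.one_mul, h1]
  · rw [Matrix.mul_assoc, ← Matrix.mul_assoc T, h2, Matrix.one_mul, k2]
  · rw [Matrix.mul_assoc, h3, ← Matrix.mul_assoc, k3, Matrix.mul_assoc]

/-- Schur's lemma: inequivalent irreducible families have no nonzero intertwiner. -/
theorem eq_zero_of_intertwines (hY : IsIrreducibleFamily Y) (hZ : IsIrreducibleFamily Z)
    (hYZ : ¬ AreEquivalentFamilies Y Z) {T : Matrix (Fin r) (Fin q) ℂ}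
    (hT : ∀ a, T * Y a = Z a * T) : T = 0 := by
  by_contra hne
  refine hYZ ?_
  have hinj : Function.Injective T.mulVecLin := by
    rw [← LinearMap.ker_eq_bot]
    refine (hY.2 (LinearMap.ker T.mulVecLin) fun a v hv => ?_).resolve_right fun h => hne ?_
    · rw [LinearMap.mem_ker, Matrix.mulVecLin_apply] at hv ⊢
      rw [Matrix.mulVec_mulVec, hT, ← Matrix.mulVec_mulVec, hv, Matrix.mulVec_zero]
    · rw [LinearMap.ker_eq_top] at h
      exact Matrix.toLin'.injective (h.trans Matrix.mulVecLin_zero.symm)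
  have hsurj : Function.Surjective T.mulVecLin := by
    rw [← LinearMap.range_eq_top]
    refine (hZ.2 (LinearMap.range T.mulVecLin) fun a v hv => ?_).resolve_left fun h => hne ?_
    · obtain ⟨w, rfl⟩ := hv
      refine ⟨(Y a).mulVec w, ?_⟩
      rw [Matrix.mulVecLin_apply, Matrix.mulVecLin_apply, Matrix.mulVec_mulVec,
        Matrix.mulVec_mulVec, hT]
    · rw [LinearMap.range_eq_bot] at h
      exact Matrix.toLin'.injective (h.trans Matrix.mulVecLin_zero.symm)
  let e := LinearEquiv.ofBijective T.mulVecLin ⟨hinj, hsurj⟩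
  have hTe : T = LinearMap.toMatrix' (e : (Fin q → ℂ) →ₗ[ℂ] (Fin r → ℂ)) := by
    rw [← LinearMap.toMatrix'_toLin' T]
    rfl
  refine ⟨T, LinearMap.toMatrix' (e.symm : (Fin r → ℂ) →ₗ[ℂ] (Fin q → ℂ)), ?_, ?_, hT⟩
  · rw [hTe, ← LinearMap.toMatrix'_comp, LinearEquiv.symm_comp, LinearMap.toMatrix'_id]
  · rw [hTe, ← LinearMap.toMatrix'_comp, LinearEquiv.comp_symm, LinearMap.toMatrix'_id]

/-- Schur's lemma: the commutant of an irreducible family is scalar. -/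
theorem exists_eq_smul_one_of_commutes (hY : IsIrreducibleFamily Y) {T : Matrix (Fin q) (Fin q) ℂ}
    (hT : ∀ a, T * Y a = Y a * T) : ∃ c : ℂ, T = c • (1 : Matrix (Fin q) (Fin q) ℂ) := by
  have : NeZero q := ⟨hY.1.ne'⟩
  obtain ⟨c, hc⟩ := Module.End.exists_eigenvalue (Matrix.toLin' T)
  obtain ⟨v, hv⟩ := hc.exists_hasEigenvector
  refine ⟨c, ?_⟩
  have hinv : ∀ a, ∀ w ∈ LinearMap.ker (T - c • (1 : Matrix (Fin q) (Fin q) ℂ)).mulVecLin,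
      (Y a).mulVec w ∈ LinearMap.ker (T - c • (1 : Matrix (Fin q) (Fin q) ℂ)).mulVecLin := by
    intro a w hw
    rw [LinearMap.mem_ker, Matrix.mulVecLin_apply] at hw ⊢
    have : (T - c • (1 : Matrix (Fin q) (Fin q) ℂ)) * Y a =
        Y a * (T - c • (1 : Matrix (Fin q) (Fin q) ℂ)) := by
      rw [Matrix.sub_mul, Matrix.mul_sub, hT]
      simp
    rw [Matrix.mulVec_mulVec, this, ← Matrix.mulVec_mulVec, hw, Matrix.mulVec_zero]
  rcases hY.2 _ hinv with h | h
  · exfalso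
    refine hv.2 ((Submodule.mem_bot ℂ).1 (h ▸ ?_))
    have := hv.apply_eq_smul
    rw [LinearMap.mem_ker, Matrix.mulVecLin_apply, Matrix.sub_mulVec, Matrix.smul_mulVec,
      Matrix.one_mulVec, ← Matrix.toLin'_apply, this, sub_self]
  · rw [LinearMap.ker_eq_top] at h
    exact sub_eq_zero.1 (Matrix.toLin'.injective (h.trans Matrix.mulVecLin_zero.symm))

/-- Equivalent irreducible Hermitian families are unitarily equivalent: for an intertwiner `T`, the
operator `T† T` commutes with the family, so `T` is a multiple of a unitary. -/
theorem AreEquivalentFamilies.exists_unitary (hY : IsIrreducibleFamily Y)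
    (hYh : ∀ a, (Y a).IsHermitian) (hZh : ∀ a, (Z a).IsHermitian)
    (h : AreEquivalentFamilies Y Z) :
    ∃ Q : Matrix (Fin r) (Fin q) ℂ, Q.conjTranspose * Q = 1 ∧ Q * Q.conjTranspose = 1 ∧
      ∀ a, Q * Y a = Z a * Q := by
  obtain ⟨T, T', h1, h2, h3⟩ := h
  have h3' : ∀ a, Y a * T.conjTranspose = T.conjTranspose * Z a := by
    intro a
    have := congrArg Matrix.conjTranspose (h3 a)
    rwa [Matrix.conjTranspose_mul, Matrix.conjTranspose_mul, (hYh a).eq, (hZh a).eq] at this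
  obtain ⟨c, hc⟩ := exists_eq_smul_one_of_commutes hY (T := T.conjTranspose * T) fun a => by
    rw [Matrix.mul_assoc, h3, ← Matrix.mul_assoc, ← h3', Matrix.mul_assoc]
  have hTT : T * T.conjTranspose = c • 1 := by
    calc T * T.conjTranspose = T * (T.conjTranspose * T) * T' := by
          rw [Matrix.mul_assoc, Matrix.mul_assoc, h2, Matrix.mul_one]
      _ = c • 1 := by rw [hc, Matrix.mul_smul, Matrix.mul_one, Matrix.smul_mul, h2]
  let o : Fin q := ⟨0, hY.1⟩
  have hc0 : 0 ≤ c := by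
    have := (Matrix.posSemidef_conjTranspose_mul_self T).diag_nonneg (i := o)
    rw [hc] at this
    simpa using this
  have hcne : c ≠ 0 := by
    rintro rfl
    rw [zero_smul, Matrix.conjTranspose_mul_self_eq_zero] at hc
    rw [hc, Matrix.mul_zero] at h1
    have := congrFun (congrFun h1 o) o
    simp at this
  obtain ⟨x, hx0, rfl⟩ : ∃ x : ℝ, 0 ≤ x ∧ (x : ℂ) = c :=
    ⟨c.re, (Complex.nonneg_iff.1 hc0).1, Complex.ext rfl (Complex.nonneg_iff.1 hc0).2⟩
  have hxx : (((Real.sqrt x)⁻¹ : ℝ) : ℂ) * (((Real.sqrt x)⁻¹ : ℝ) : ℂ) * x = 1 := by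
    have hx : x ≠ 0 := fun h => hcne (by rw [h, Complex.ofReal_zero])
    rw [← Complex.ofReal_mul, ← Complex.ofReal_mul, ← mul_inv, Real.mul_self_sqrt hx0,
      inv_mul_cancel₀ hx, Complex.ofReal_one]
  refine ⟨(((Real.sqrt x)⁻¹ : ℝ) : ℂ) • T, ?_, ?_, fun a => ?_⟩
  · rw [Matrix.conjTranspose_smul, Matrix.smul_mul, Matrix.mul_smul, hc, smul_smul, smul_smul,
      Complex.star_def, Complex.conj_ofReal, hxx, one_smul]
  · rw [Matrix.conjTranspose_smul, Matrix.smul_mul, Matrix.mul_smul, hTT, smul_smul, smul_smul,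
      Complex.star_def, Complex.conj_ofReal, hxx, one_smul]
  · rw [Matrix.smul_mul, Matrix.mul_smul, h3]

end Schur

/-! ### Existence of Schur bases -/

section Reducibility

variable {V : Type} [NormedAddCommGroup V] [InnerProductSpace ℂ V]
  {κ : Type} {T : κ → V →ₗ[ℂ] V}

/-- `W` is mapped to itself by every `T a`. -/
def IsInvariantUnder (T : κ → V →ₗ[ℂ] V) (W : Submodule ℂ V) : Prop :=
  ∀ a, ∀ v ∈ W, T a v ∈ W

/-- `W` is a minimal nonzero invariant subspace. -/
def IsIrreducibleSubspace (T : κ → V →ₗ[ℂ] V) (W : Submodule ℂ V) : Prop :=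
  W ≠ ⊥ ∧ IsInvariantUnder T W ∧ ∀ W' ≤ W, IsInvariantUnder T W' → W' = ⊥ ∨ W' = W

theorem exists_orthogonal_irreducible_decomposition [FiniteDimensional ℂ V]
    (hT : ∀ a, (T a).IsSymmetric)
    (M : Submodule ℂ V) (hM : IsInvariantUnder T M) :
    ∃ s : Set (Submodule ℂ V), s.Finite ∧ (∀ W ∈ s, IsIrreducibleSubspace T W) ∧
      s.Pairwise (· ⟂ ·) ∧ sSup s = M := by
  induction h : Module.finrank ℂ M using Nat.strong_induction_on generalizing M with
  | _ k ih =>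
    by_cases hbot : M = ⊥
    · exact ⟨∅, Set.finite_empty, by simp, by simp, by simp [hbot]⟩
    obtain ⟨W, ⟨hWM, hWne, hWinv⟩, hWmin⟩ := WellFounded.has_min
      (wellFounded_lt (α := Submodule ℂ V))
      {W | W ≤ M ∧ W ≠ ⊥ ∧ IsInvariantUnder T W} ⟨M, le_rfl, hbot, hM⟩
    have hWirr : IsIrreducibleSubspace T W := by
      refine ⟨hWne, hWinv, fun W' hW' hinv => ?_⟩
      by_contra! hc
      exact hWmin W' ⟨hW'.trans hWM, hc.1, hinv⟩ (lt_of_le_of_ne hW' hc.2)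
    have hsup : W ⊔ (Wᗮ ⊓ M) = M := Submodule.sup_orthogonal_inf_of_hasOrthogonalProjection hWM
    have hlt : Wᗮ ⊓ M < M := by
      refine lt_of_le_of_ne inf_le_right fun heq => hWne ?_
      have : W ≤ Wᗮ := hWM.trans (inf_eq_right.1 heq)
      rw [eq_bot_iff, ← Submodule.inf_orthogonal_eq_bot W]
      exact le_inf le_rfl this
    obtain ⟨s, hfin, hs, hpair, hsSup⟩ := ih _ (h ▸ Submodule.finrank_lt_finrank_of_lt hlt)
      (Wᗮ ⊓ M) (fun a v hv => ⟨fun w hw => by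
        rw [← hT a w v]
        exact hv.1 _ (hWinv a w hw), hM a v hv.2⟩) rfl
    refine ⟨insert W s, hfin.insert W, ?_, ?_, ?_⟩
    · rintro W' (rfl | hW')
      · exact hWirr
      · exact hs W' hW'
    · rw [Set.pairwise_insert]
      refine ⟨hpair, fun W' hW' _ => ?_⟩
      have : W ⟂ W' := by
        have h1 : W' ≤ Wᗮ := (le_sSup hW').trans (hsSup.le.trans inf_le_left)
        exact (Submodule.isOrtho_iff_le.2 h1).symm
      exact ⟨this, this.symm⟩
    · rw [sSup_insert, hsSup, hsup]

/-- `w` is an orthonormal basis of `W` in which the operators `T a` have the matrices `Y a`. -/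
structure OrthonormalFrame (T : κ → V →ₗ[ℂ] V) (W : Submodule ℂ V) {q : ℕ}
    (Y : κ → Matrix (Fin q) (Fin q) ℂ) (w : Fin q → V) : Prop where
  orthonormal : Orthonormal ℂ w
  span_eq : Submodule.span ℂ (Set.range w) = W
  apply_eq : ∀ a b, T a (w b) = ∑ c, Y a c b • w c

theorem IsIrreducibleSubspace.exists_frame [FiniteDimensional ℂ V]
    (hT : ∀ a, (T a).IsSymmetric) {W : Submodule ℂ V}
    (hW : IsIrreducibleSubspace T W) :
    ∃ (q : ℕ) (Y : κ → Matrix (Fin q) (Fin q) ℂ) (w : Fin q → V),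
      OrthonormalFrame T W Y w ∧ IsIrreducibleFamily Y ∧ ∀ a, (Y a).IsHermitian := by
  let e := stdOrthonormalBasis ℂ W
  let w : Fin (Module.finrank ℂ W) → V := fun b => e b
  have hwon : Orthonormal ℂ w := e.orthonormal.comp_linearIsometry W.subtypeₗᵢ
  have hspan : Submodule.span ℂ (Set.range w) = W := by
    have h1 : Set.range w = W.subtype '' Set.range e := by
      rw [← Set.range_comp]; rfl
    rw [h1, Submodule.span_image, ← e.coe_toBasis, e.toBasis.span_eq, Submodule.map_top,
      Submodule.range_subtype]
  let Y : κ → Matrix (Fin (Module.finrank ℂ W)) (Fin (Module.finrank ℂ W)) ℂ := fun a =>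
    Matrix.of fun c b => inner ℂ (w c) (T a (w b))
  have happ : ∀ a b, T a (w b) = ∑ c, Y a c b • w c := by
    intro a b
    have h1 := e.sum_repr' ⟨T a (w b), hW.2.1 a _ (e b).2⟩
    have h2 := congrArg W.subtype h1
    rw [map_sum] at h2
    exact h2.symm
  refine ⟨_, Y, w, ⟨hwon, hspan, happ⟩, ⟨?_, fun P hP => ?_⟩, fun a => ?_⟩
  · rw [Module.finrank_pos_iff, Submodule.nontrivial_iff_ne_bot]
    exact hW.1
  · let φ := Fintype.linearCombination ℂ w
    have hφinj : Function.Injective φ := by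
      exact hwon.linearIndependent.fintypeLinearCombination_injective
    have hφran : LinearMap.range φ = W := by
      exact (Fintype.range_linearCombination ℂ w).trans hspan
    have hφT : ∀ a v, T a (φ v) = φ ((Y a).mulVec v) := by
      intro a v
      simp only [φ, Fintype.linearCombination_apply, map_sum, map_smul, happ, Finset.smul_sum,
        Matrix.mulVec, dotProduct, Finset.sum_smul, smul_smul]
      rw [Finset.sum_comm]
      simp only [mul_comm]
    have hinv : IsInvariantUnder T (P.map φ) := by
      rintro a _ ⟨v, hv, rfl⟩
      rw [hφT]
      exact ⟨_, hP a v hv, rfl⟩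
    rcases hW.2.2 (P.map φ) (LinearMap.map_le_range.trans hφran.le) hinv with h | h
    · left
      exact Submodule.map_injective_of_injective hφinj (h.trans (Submodule.map_bot φ).symm)
    · right
      exact Submodule.map_injective_of_injective hφinj
        (h.trans (hφran.symm.trans (Submodule.map_top φ).symm))
  · ext c b
    simp only [Y, Matrix.conjTranspose_apply, Matrix.of_apply]
    rw [← hT a, Complex.star_def, inner_conj_symm]

/-- A unitary that intertwines `Y` and `Z` turns a frame with matrices `Z` into one with matrices
`Y`. -/
theorem OrthonormalFrame.rotate {W : Submodule ℂ V} {q r : ℕ}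
    {Y : κ → Matrix (Fin q) (Fin q) ℂ} {Z : κ → Matrix (Fin r) (Fin r) ℂ} {w : Fin r → V}
    (hw : OrthonormalFrame T W Z w) {Q : Matrix (Fin r) (Fin q) ℂ}
    (hQ : Q.conjTranspose * Q = 1) (hQ' : Q * Q.conjTranspose = 1)
    (hQY : ∀ a, Q * Y a = Z a * Q) :
    OrthonormalFrame T W Y fun b => ∑ c, Q c b • w c := by
  refine ⟨?_, le_antisymm ?_ ?_, fun a b => ?_⟩
  · rw [orthonormal_iff_ite]
    intro b b'
    have := congrFun (congrFun hQ b) b'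
    rw [Matrix.one_apply, Matrix.mul_apply] at this
    rw [← this]
    simp only [sum_inner, inner_sum, inner_smul_left, inner_smul_right,
      orthonormal_iff_ite.1 hw.orthonormal, Matrix.conjTranspose_apply]
    simp [mul_comm]
  · rw [Submodule.span_le]
    rintro _ ⟨b, rfl⟩
    rw [← hw.span_eq]
    exact Submodule.sum_mem _ fun c _ => Submodule.smul_mem _ _ (Submodule.subset_span ⟨c, rfl⟩)
  · rw [← hw.span_eq, Submodule.span_le]
    rintro _ ⟨c, rfl⟩
    have : w c = ∑ b, star (Q c b) • ∑ c', Q c' b • w c' := by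
      simp only [Finset.smul_sum, smul_smul]
      rw [Finset.sum_comm]
      simp only [← Finset.sum_smul]
      have h1 : ∀ c', ∑ b, star (Q c b) * Q c' b = (1 : Matrix (Fin r) (Fin r) ℂ) c' c := by
        intro c'
        rw [← hQ', Matrix.mul_apply]
        exact Finset.sum_congr rfl fun b _ => by rw [Matrix.conjTranspose_apply, mul_comm]
      rw [Finset.sum_congr rfl fun c' _ => by rw [h1]]
      simp [Matrix.one_apply]
    rw [SetLike.mem_coe, this]
    exact Submodule.sum_mem _ fun b _ => Submodule.smul_mem _ _ (Submodule.subset_span ⟨b, rfl⟩)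
  · simp only [map_sum, map_smul, hw.apply_eq, Finset.smul_sum, smul_smul]
    rw [Finset.sum_comm]
    conv_rhs => rw [Finset.sum_comm]
    refine Finset.sum_congr rfl fun c _ => ?_
    rw [← Finset.sum_smul, ← Finset.sum_smul]
    congr 1
    have := congrFun (congrFun (hQY a) c) b
    rw [Matrix.mul_apply, Matrix.mul_apply] at this
    rw [Finset.sum_congr rfl fun i _ => mul_comm (Q i b) (Z a c i), ← this]
    exact Finset.sum_congr rfl fun i _ => mul_comm _ _

end Reducibility

/-- Hermitian operators have a Schur basis: split the space into orthogonal irreducible subspaces,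
group these by equivalence, and choose in each a frame in which the operators have the same matrices
as in a fixed representative of its class. -/
theorem exists_schurBasis {m : Type} [Fintype m] [DecidableEq m] {κ : Type}
    (X : κ → Matrix m m ℂ) (hX : ∀ a, (X a).IsHermitian) :
    ∃ r : ℕ, Nonempty (SchurBasis X (Fin r)) := by
  classical
  let T : κ → EuclideanSpace ℂ m →ₗ[ℂ] EuclideanSpace ℂ m := fun a => Matrix.toEuclideanLin (X a)
  have hT : ∀ a, (T a).IsSymmetric := fun a => Matrix.isSymmetric_toEuclideanLin_iff.2 (hX a)
  obtain ⟨s, hfin, hirr, hpair, hsup⟩ := exists_orthogonal_irreducible_decomposition hT ⊤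
    fun _ _ _ => trivial
  have : Fintype s := hfin.fintype
  choose q Y w hframe hYirr hYherm using fun W : s => (hirr W.1 W.2).exists_frame hT
  let st : Setoid s := ⟨fun W W' => AreEquivalentFamilies (Y W) (Y W'),
    fun W => .refl _, fun h => h.symm, fun h h' => h.trans h'⟩
  let g : Quotient st ≃ Fin (Fintype.card (Quotient st)) := Fintype.equivFin _
  let rep : Fin (Fintype.card (Quotient st)) → s := fun l => (g.symm l).out
  let fib : Fin (Fintype.card (Quotient st)) → Type := fun l => {W : s // g ⟦W⟧ = l}
  have hrep : ∀ l, g ⟦rep l⟧ = l := fun l => by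
    simp only [rep, Quotient.out_eq, Equiv.apply_symm_apply]
  let f : ∀ l, Fin (Fintype.card (fib l)) ≃ fib l := fun l => (Fintype.equivFin _).symm
  have hequiv : ∀ (l) (W : fib l), AreEquivalentFamilies (Y (rep l)) (Y W.1) := by
    intro l W
    have : (⟦rep l⟧ : Quotient st) = ⟦W.1⟧ := g.injective ((hrep l).trans W.2.symm)
    exact Quotient.exact this
  have hex : ∀ (l) (W : fib l), ∃ u : Fin (q (rep l)) → EuclideanSpace ℂ m,
      OrthonormalFrame T W.1.1 (Y (rep l)) u := by
    intro l W
    obtain ⟨Q, h1, h2, h3⟩ := (hequiv l W).exists_unitary (hYirr _) (hYherm _) (hYherm _)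
    exact ⟨_, (hframe W.1).rotate h1 h2 h3⟩
  choose u hu using hex
  let v : (Σ l, Fin (Fintype.card (fib l)) × Fin (q (rep l))) → EuclideanSpace ℂ m :=
    fun j => u j.1 (f j.1 j.2.1) j.2.2
  have humem : ∀ l W b, u l W b ∈ W.1.1 := fun l W b => by
    rw [← (hu l W).span_eq]
    exact Submodule.subset_span ⟨b, rfl⟩
  have hv : Orthonormal ℂ v := by
    constructor
    · rintro ⟨l, a, b⟩
      exact (hu l (f l a)).orthonormal.1 b
    · rintro ⟨l, a, b⟩ ⟨l', a', b'⟩ hne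
      by_cases hWW : (f l a).1 = (f l' a').1
      · obtain rfl : l = l' := by rw [← (f l a).2, ← (f l' a').2, hWW]
        obtain rfl : a = a' := (f l).injective (Subtype.ext hWW)
        refine (hu l (f l a)).orthonormal.2 ?_
        rintro rfl
        exact hne rfl
      · have := hpair (f l a).1.2 (f l' a').1.2 fun h => hWW (Subtype.ext h)
        exact this.inner_eq (humem _ _ _) (humem _ _ _)
  have hspan : ⊤ ≤ Submodule.span ℂ (Set.range v) := by
    rw [← hsup]
    refine sSup_le fun W hW => ?_
    let W' : fib (g ⟦⟨W, hW⟩⟧) := ⟨⟨W, hW⟩, rfl⟩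
    refine (hu _ W').span_eq.symm.le.trans (Submodule.span_le.2 ?_)
    rintro _ ⟨b, rfl⟩
    refine Submodule.subset_span ⟨⟨_, (f _).symm W', b⟩, ?_⟩
    simp only [v, Equiv.apply_symm_apply]
  let B := OrthonormalBasis.mk hv hspan
  let U : Matrix m (Σ l, Fin (Fintype.card (fib l)) × Fin (q (rep l))) ℂ :=
    Matrix.of fun x j => v j x
  have hUU : U.conjTranspose * U = 1 := by
    ext i j
    rw [Matrix.one_apply, ← orthonormal_iff_ite.1 hv, Matrix.mul_apply, PiLp.inner_apply]
    exact Finset.sum_congr rfl fun x _ => by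
      simp [U, mul_comm]
  have hcard : Fintype.card m =
      Fintype.card (Σ l, Fin (Fintype.card (fib l)) × Fin (q (rep l))) := by
    rw [← Module.finrank_eq_card_basis B.toBasis, finrank_euclideanSpace]
  have hUU' : U * U.conjTranspose = 1 :=
    (Matrix.mul_eq_one_comm_of_card_eq _ _ ℂ hcard).2 hUU
  have hXU : ∀ a, X a * U = U * Matrix.blockDiagonal' (fun l =>
      (1 : Matrix (Fin (Fintype.card (fib l))) (Fin (Fintype.card (fib l))) ℂ) ⊗ₖ Y (rep l) a) := by
    intro a
    ext x ⟨l, c, b⟩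
    have h1 := congrArg (fun z : EuclideanSpace ℂ m => z x) ((hu l (f l c)).apply_eq a b)
    have h2 : (X a * U) x ⟨l, c, b⟩ = (T a (v ⟨l, c, b⟩)) x := by
      simp [T, U, Matrix.mul_apply, Matrix.toLpLin_apply, Matrix.mulVec, dotProduct]
    rw [h2]
    refine h1.trans ?_
    rw [Matrix.mul_apply, Fintype.sum_sigma, Finset.sum_eq_single l, Fintype.sum_prod_type,
      Finset.sum_eq_single c]
    · simp [U, v, Matrix.blockDiagonal'_apply_eq, mul_comm]
    · intro c' _ hc'
      simp [Matrix.blockDiagonal'_apply_eq, Matrix.one_apply_ne hc']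
    · simp
    · intro l' _ hl'
      refine Finset.sum_eq_zero fun j _ => ?_
      rw [Matrix.blockDiagonal'_apply_ne _ _ _ hl', mul_zero]
    · simp
  refine ⟨Fintype.card (Quotient st), ⟨{
    mult := fun l => Fintype.card (fib l)
    dim := fun l => q (rep l)
    mult_pos := fun l => Fintype.card_pos_iff.2 ⟨⟨rep l, hrep l⟩⟩
    U := U
    conjTranspose_mul := hUU
    mul_conjTranspose := hUU'
    irrep := fun l => Y (rep l)
    decomp := fun a => ?_
    irreducible := fun l => hYirr _
    inequivalent := fun l l' hl h => hl ?_ }⟩⟩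
  · rw [← hXU, Matrix.mul_assoc, hUU', Matrix.mul_one]
  · rw [← hrep l, ← hrep l']
    exact congrArg g (Quotient.sound h)

/-! ### Generators of Lindblad form and their stationary operators -/

section Generator

variable {m ι : Type} [Fintype m] [Fintype ι]

/-- The map `ρ ↦ ∑ₖ Jₖ ρ Jₖ† - K ρ - ρ K†`. With `K = (i/ħ) H + ½ ∑ₖ Jₖ† Jₖ` this is the Lindblad
generator with Hamiltonian `H` and jump operators `Jₖ`; of this form of `K` only its consequence
`K + K† = ∑ₖ Jₖ† Jₖ`, the preservation of the trace, is used. -/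
def gksl (K : Matrix m m ℂ) (J : ι → Matrix m m ℂ) : Matrix m m ℂ →ₗ[ℂ] Matrix m m ℂ where
  toFun ρ := ∑ k, J k * ρ * (J k).conjTranspose - K * ρ - ρ * K.conjTranspose
  map_add' ρ η := by
    simp only [Matrix.mul_add, Matrix.add_mul, Finset.sum_add_distrib]
    abel
  map_smul' c ρ := by
    simp only [Matrix.mul_smul, Matrix.smul_mul, ← Finset.smul_sum, smul_sub, RingHom.id_apply]

variable {K : Matrix m m ℂ} {J : ι → Matrix m m ℂ}

theorem gksl_apply (K : Matrix m m ℂ) (J : ι → Matrix m m ℂ) (ρ : Matrix m m ℂ) :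
    gksl K J ρ = ∑ k, J k * ρ * (J k).conjTranspose - K * ρ - ρ * K.conjTranspose := rfl

theorem trace_gksl (hK : K + K.conjTranspose = ∑ k, (J k).conjTranspose * J k)
    (ρ : Matrix m m ℂ) : (gksl K J ρ).trace = 0 := by
  have h1 : ∀ k, (J k * ρ * (J k).conjTranspose).trace = ((J k).conjTranspose * J k * ρ).trace :=
    fun k => by rw [Matrix.trace_mul_comm, Matrix.mul_assoc]
  rw [gksl_apply, Matrix.trace_sub, Matrix.trace_sub, Matrix.trace_sum,
    Finset.sum_congr rfl fun k _ => h1 k, ← Matrix.trace_sum, ← Matrix.sum_mul, ← hK,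
    Matrix.add_mul, Matrix.trace_add, Matrix.trace_mul_comm ρ]
  ring

theorem gksl_conjTranspose (ρ : Matrix m m ℂ) :
    gksl K J ρ.conjTranspose = (gksl K J ρ).conjTranspose := by
  simp only [gksl_apply, Matrix.conjTranspose_sub, Matrix.conjTranspose_sum,
    Matrix.conjTranspose_mul, Matrix.conjTranspose_conjTranspose, Matrix.mul_assoc]
  abel

/-- The dissipation identity. When `ρ` is positive definite, `ρ` and `X ρ` are stationary and the
trace is preserved, the left-hand side is traceless and the right-hand side is positive
semidefinite, so `X` must commute with all jump operators. -/
theorem gksl_dissipation (ρ X : Matrix m m ℂ) :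
    gksl K J (X * ρ * X.conjTranspose) - gksl K J (X * ρ) * X.conjTranspose
      - X * gksl K J (ρ * X.conjTranspose) + X * gksl K J ρ * X.conjTranspose =
    ∑ k, (J k * X - X * J k) * ρ * (J k * X - X * J k).conjTranspose := by
  have h : ∀ k, (J k * X - X * J k) * ρ * (J k * X - X * J k).conjTranspose =
      J k * (X * ρ * X.conjTranspose) * (J k).conjTranspose
      - J k * (X * ρ) * (J k).conjTranspose * X.conjTranspose
      - X * (J k * (ρ * X.conjTranspose) * (J k).conjTranspose)
      + X * (J k * ρ * (J k).conjTranspose) * X.conjTranspose := by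
    intro k
    simp only [Matrix.conjTranspose_sub, Matrix.conjTranspose_mul]
    noncomm_ring
  simp only [h, Finset.sum_add_distrib, Finset.sum_sub_distrib, gksl_apply, ← Matrix.sum_mul,
    ← Matrix.mul_sum]
  noncomm_ring

theorem eq_zero_of_trace_mul_posDef_mul [DecidableEq m]
    {ρ : Matrix m m ℂ} (hρ : ρ.PosDef)
    {C : Matrix m m ℂ} (h : (C * ρ * C.conjTranspose).trace = 0) : C = 0 := by
  have h0 : C * ρ * C.conjTranspose = 0 :=
    (hρ.posSemidef.mul_mul_conjTranspose_same C).trace_eq_zero_iff.1 h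
  have hv : ∀ v, C.conjTranspose.mulVec v = 0 := by
    intro v
    by_contra hne
    have hpos := hρ.dotProduct_mulVec_pos hne
    rw [Matrix.star_mulVec, Matrix.conjTranspose_conjTranspose, ← Matrix.dotProduct_mulVec,
      Matrix.mulVec_mulVec, Matrix.mulVec_mulVec, h0, Matrix.zero_mulVec,
      dotProduct_zero] at hpos
    exact lt_irrefl _ hpos
  have : C.conjTranspose = 0 := by
    ext i j
    have := congrFun (hv (Pi.single j 1)) i
    simpa using this
  rwa [Matrix.conjTranspose_eq_zero] at this

/-- If there is a positive definite stationary operator `ρ`, every stationary operator is `X ρ` with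
`X` commuting with all jump operators. -/
theorem exists_commuting_of_gksl_eq_zero [DecidableEq m]
    (hK : K + K.conjTranspose = ∑ k, (J k).conjTranspose * J k) {ρ η : Matrix m m ℂ}
    (hρ : ρ.PosDef) (hρ0 : gksl K J ρ = 0) (hη : gksl K J η = 0) :
    ∃ X : Matrix m m ℂ, η = X * ρ ∧ ∀ k, X * J k = J k * X := by
  have hdet : IsUnit ρ.det := (Matrix.isUnit_iff_isUnit_det ρ).1 hρ.isUnit
  obtain ⟨X, hX⟩ : ∃ X, X * ρ = η :=
    ⟨η * ρ⁻¹, by rw [Matrix.mul_assoc, Matrix.nonsing_inv_mul _ hdet, Matrix.mul_one]⟩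
  have h1 : gksl K J (ρ * X.conjTranspose) = 0 := by
    have : ρ * X.conjTranspose = η.conjTranspose := by
      rw [← hX, Matrix.conjTranspose_mul, hρ.1.eq]
    rw [this, gksl_conjTranspose, hη, Matrix.conjTranspose_zero]
  have h2 := congrArg Matrix.trace (gksl_dissipation (K := K) (J := J) ρ X)
  rw [hX, hη, h1, hρ0, Matrix.zero_mul, Matrix.mul_zero, Matrix.zero_mul, sub_zero, sub_zero,
    add_zero, trace_gksl hK, Matrix.trace_sum] at h2
  have h3 := (Finset.sum_eq_zero_iff_of_nonneg fun k _ =>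
    (hρ.posSemidef.mul_mul_conjTranspose_same (J k * X - X * J k)).trace_nonneg).1 h2.symm
  refine ⟨X, hX.symm, fun k => ?_⟩
  exact (sub_eq_zero.1 (eq_zero_of_trace_mul_posDef_mul hρ (h3 k (Finset.mem_univ k)))).symm

theorem gksl_unitary_conj [DecidableEq m]
    {U : Matrix m m ℂ} (hU : U * U.conjTranspose = 1) (ρ : Matrix m m ℂ) :
    gksl (U.conjTranspose * K * U) (fun k => U.conjTranspose * J k * U)
      (U.conjTranspose * ρ * U) = U.conjTranspose * gksl K J ρ * U := by
  have key : ∀ A B : Matrix m m ℂ, (U.conjTranspose * A * U) * (U.conjTranspose * B * U) =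
      U.conjTranspose * (A * B) * U := by
    intro A B
    calc (U.conjTranspose * A * U) * (U.conjTranspose * B * U)
        = U.conjTranspose * A * (U * U.conjTranspose) * B * U := by noncomm_ring
      _ = U.conjTranspose * (A * B) * U := by rw [hU]; noncomm_ring
  have hct : ∀ A : Matrix m m ℂ, (U.conjTranspose * A * U).conjTranspose =
      U.conjTranspose * A.conjTranspose * U := by
    intro A
    simp [Matrix.mul_assoc]
  simp only [gksl_apply, hct, key, Matrix.mul_sub, Matrix.sub_mul, Matrix.mul_sum, Matrix.sum_mul]

/-- In a stationary solution of a classical rate equation there is no flow from the sites with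
positive weight to the others. -/
theorem rate_eq_zero_of_stationary {w : m → m → ℝ} (hw : ∀ a b, 0 ≤ w a b) {x : m → ℝ}
    (h : ∀ a, ∑ b, w a b * x b = ∑ b, w b a * x a) {a b : m} (ha : 0 < x a) (hb : x b ≤ 0) :
    w b a = 0 := by
  classical
  let P : Finset m := Finset.univ.filter fun a => 0 < x a
  have h1 : ∑ a ∈ P, ∑ b, w a b * x b = ∑ a ∈ P, ∑ b, w b a * x a :=
    Finset.sum_congr rfl fun a _ => h a
  have hsplit : ∀ f : m → ℝ, ∑ b, f b = ∑ b ∈ P, f b + ∑ b ∈ Pᶜ, f b := fun f =>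
    (Finset.sum_add_sum_compl P f).symm
  simp only [hsplit, Finset.sum_add_distrib] at h1
  -- the flow inside `P` cancels; what is left is a nonpositive inflow and a nonnegative outflow
  rw [Finset.sum_comm (s := P) (t := P)] at h1
  have h2 := add_left_cancel h1
  have hle : ∑ a ∈ P, ∑ b ∈ Pᶜ, w a b * x b ≤ 0 :=
    Finset.sum_nonpos fun a _ => Finset.sum_nonpos fun b hb => by
      have : x b ≤ 0 := by simpa [P] using hb
      exact mul_nonpos_of_nonneg_of_nonpos (hw a b) this
  have hnn : ∀ a ∈ P, ∀ b ∈ Pᶜ, 0 ≤ w b a * x a := fun a ha b _ =>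
    mul_nonneg (hw b a) (by simpa [P] using ha : 0 < x a).le
  have h3 : ∑ a ∈ P, ∑ b ∈ Pᶜ, w b a * x a = 0 :=
    le_antisymm (h2 ▸ hle) (Finset.sum_nonneg fun a ha => Finset.sum_nonneg (hnn a ha))
  have haP : a ∈ P := by simpa [P] using ha
  have hbP : b ∈ Pᶜ := by simpa [P] using hb
  have h4 := (Finset.sum_eq_zero_iff_of_nonneg fun a ha => Finset.sum_nonneg (hnn a ha)).1 h3 a haP
  have h5 := (Finset.sum_eq_zero_iff_of_nonneg (hnn a haP)).1 h4 b hbP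
  exact (mul_eq_zero.1 h5).resolve_right ha.ne'

/-- On a diagonal matrix, the diagonal of the generator is a classical rate equation with the rates
`w a b = ∑ₖ |(Jₖ)_{ab}|²`. -/
theorem gksl_diagonal_apply [DecidableEq m]
    (hK : K + K.conjTranspose = ∑ k, (J k).conjTranspose * J k)
    (x : m → ℝ) (a : m) :
    gksl K J (Matrix.diagonal fun a => (x a : ℂ)) a a =
      ((∑ b, (∑ k, Complex.normSq (J k a b)) * x b -
        ∑ b, (∑ k, Complex.normSq (J k b a)) * x a : ℝ) : ℂ) := by
  have h1 : ∀ k, (J k * Matrix.diagonal (fun a => (x a : ℂ)) * (J k).conjTranspose) a a =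
      ∑ b, (Complex.normSq (J k a b) : ℂ) * x b := by
    intro k
    rw [Matrix.mul_apply]
    refine Finset.sum_congr rfl fun b _ => ?_
    rw [Matrix.mul_diagonal, Matrix.conjTranspose_apply, Complex.star_def,
      mul_right_comm, Complex.mul_conj]
  have h2 : K a a + star (K a a) = ∑ k, ∑ b, (Complex.normSq (J k b a) : ℂ) := by
    have := congrFun (congrFun hK a) a
    rw [Matrix.add_apply, Matrix.conjTranspose_apply, Matrix.sum_apply] at this
    rw [this]
    refine Finset.sum_congr rfl fun k _ => ?_
    rw [Matrix.mul_apply]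
    refine Finset.sum_congr rfl fun b _ => ?_
    rw [Matrix.conjTranspose_apply, Complex.star_def, mul_comm, Complex.mul_conj]
  rw [gksl_apply, Matrix.sub_apply, Matrix.sub_apply, Matrix.sum_apply,
    Finset.sum_congr rfl fun k _ => h1 k, Matrix.mul_diagonal, Matrix.diagonal_mul,
    Matrix.conjTranspose_apply, sub_sub, mul_comm (x a : ℂ), ← add_mul, h2, Finset.sum_comm]
  rw [Finset.sum_comm (f := fun k b => (Complex.normSq (J k b a) : ℂ))]
  push_cast
  simp only [Finset.sum_mul]

end Generator

section Irreducible

variable {q : ℕ} {ι : Type} [Fintype ι] {K : Matrix (Fin q) (Fin q) ℂ}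
  {J : ι → Matrix (Fin q) (Fin q) ℂ}

/-- The span of the eigenvectors of a stationary Hermitian `η` with positive eigenvalues is
invariant under the jump operators, by the rate equation in an eigenbasis of `η`; irreducibility
leaves only the two extreme cases. -/
theorem posDef_or_neg_posSemidef_of_gksl_eq_zero
    (hK : K + K.conjTranspose = ∑ k, (J k).conjTranspose * J k) (hJ : IsIrreducibleFamily J)
    {η : Matrix (Fin q) (Fin q) ℂ} (hη : η.IsHermitian) (hη0 : gksl K J η = 0) :
    η.PosDef ∨ (-η).PosSemidef := by
  set x := hη.eigenvalues with hx
  set U : Matrix (Fin q) (Fin q) ℂ := (hη.eigenvectorUnitary : Matrix (Fin q) (Fin q) ℂ) with hUdef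
  have hU1 : U.conjTranspose * U = 1 := by
    rw [← Matrix.star_eq_conjTranspose]; exact Unitary.coe_star_mul_self _
  have hU2 : U * U.conjTranspose = 1 := by
    rw [← Matrix.star_eq_conjTranspose]; exact Unitary.coe_mul_star_self _
  have hspec : η = U * Matrix.diagonal (fun a => (x a : ℂ)) * U.conjTranspose :=
    hη.spectral_theorem
  have hdiag : U.conjTranspose * η * U = Matrix.diagonal (fun a => (x a : ℂ)) := by
    rw [hspec]
    calc _ = (U.conjTranspose * U) * Matrix.diagonal (fun a => (x a : ℂ)) *
          (U.conjTranspose * U) := by noncomm_ring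
      _ = _ := by rw [hU1, Matrix.one_mul, Matrix.mul_one]
  let K' := U.conjTranspose * K * U
  let J' : ι → Matrix (Fin q) (Fin q) ℂ := fun k => U.conjTranspose * J k * U
  have hK' : K' + K'.conjTranspose = ∑ k, (J' k).conjTranspose * J' k := by
    have h1 : ∀ k, (J' k).conjTranspose * J' k =
        U.conjTranspose * ((J k).conjTranspose * J k) * U := by
      intro k
      simp only [J', Matrix.conjTranspose_mul, Matrix.conjTranspose_conjTranspose]
      calc _ = U.conjTranspose * (J k).conjTranspose * (U * U.conjTranspose) * J k * U := by
            noncomm_ring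
        _ = _ := by rw [hU2]; noncomm_ring
    rw [Finset.sum_congr rfl fun k _ => h1 k, ← Matrix.sum_mul, ← Matrix.mul_sum, ← hK]
    simp only [K', Matrix.conjTranspose_mul, Matrix.conjTranspose_conjTranspose]
    noncomm_ring
  have hzero : gksl K' J' (Matrix.diagonal fun a => (x a : ℂ)) = 0 := by
    rw [← hdiag, gksl_unitary_conj hU2, hη0, Matrix.mul_zero, Matrix.zero_mul]
  have hrate : ∀ a, ∑ b, (∑ k, Complex.normSq (J' k a b)) * x b =
      ∑ b, (∑ k, Complex.normSq (J' k b a)) * x a := by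
    intro a
    have := gksl_diagonal_apply hK' x a
    rw [hzero, Matrix.zero_apply] at this
    exact sub_eq_zero.1 (Complex.ofReal_eq_zero.1 this.symm)
  have hvanish : ∀ k a b, 0 < x a → x b ≤ 0 → J' k b a = 0 := by
    intro k a b ha hb
    have h1 := rate_eq_zero_of_stationary
      (fun a b => Finset.sum_nonneg fun k _ => Complex.normSq_nonneg (J' k a b)) hrate ha hb
    exact Complex.normSq_eq_zero.1 ((Finset.sum_eq_zero_iff_of_nonneg fun k _ =>
      Complex.normSq_nonneg (J' k b a)).1 h1 k (Finset.mem_univ k))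
  -- the span of the eigenvectors of `η` with positive eigenvalue
  let W : Submodule ℂ (Fin q → ℂ) :=
    { carrier := {v | ∀ b, x b ≤ 0 → (U.conjTranspose.mulVec v) b = 0}
      add_mem' := fun {v w} hv hw b hb => by
        rw [Matrix.mulVec_add, Pi.add_apply, hv b hb, hw b hb, add_zero]
      zero_mem' := fun b _ => by rw [Matrix.mulVec_zero, Pi.zero_apply]
      smul_mem' := fun c v hv b hb => by
        rw [Matrix.mulVec_smul, Pi.smul_apply, hv b hb, smul_zero] }
  have hWmem : ∀ a, U.mulVec (Pi.single a 1) ∈ W ↔ 0 < x a := by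
    intro a
    have h1 : U.conjTranspose.mulVec (U.mulVec (Pi.single a 1)) = Pi.single a 1 := by
      rw [Matrix.mulVec_mulVec, hU1, Matrix.one_mulVec]
    change (∀ b, x b ≤ 0 → (U.conjTranspose.mulVec (U.mulVec (Pi.single a 1))) b = 0) ↔ _
    rw [h1]
    refine ⟨fun h => ?_, fun h b hb => ?_⟩
    · by_contra hc
      have := h a (not_lt.1 hc)
      simp at this
    · have : b ≠ a := by rintro rfl; exact not_lt.2 hb h
      simp [this]
  have hWinv : ∀ k, ∀ v ∈ W, (J k).mulVec v ∈ W := by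
    intro k v hv b hb
    have h1 : U.conjTranspose.mulVec ((J k).mulVec v) =
        (J' k).mulVec (U.conjTranspose.mulVec v) := by
      rw [Matrix.mulVec_mulVec, Matrix.mulVec_mulVec]
      simp only [J', Matrix.mul_assoc, hU2, Matrix.mul_one]
    rw [h1]
    change ∑ a, J' k b a * (U.conjTranspose.mulVec v) a = 0
    refine Finset.sum_eq_zero fun a _ => ?_
    rcases lt_or_ge 0 (x a) with ha | ha
    · rw [hvanish k a b ha hb, zero_mul]
    · rw [hv a ha, mul_zero]
  rcases hJ.2 W hWinv with h | h
  · right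
    have hle : ∀ a, x a ≤ 0 := by
      intro a
      by_contra hc
      have := (hWmem a).2 (not_le.1 hc)
      rw [h, Submodule.mem_bot] at this
      have h2 := congrArg U.conjTranspose.mulVec this
      rw [Matrix.mulVec_mulVec, hU1, Matrix.one_mulVec, Matrix.mulVec_zero] at h2
      simpa using congrFun h2 a
    have h3 : -η = U * Matrix.diagonal (fun a => ((-x a : ℝ) : ℂ)) * U.conjTranspose := by
      rw [hspec, ← Matrix.neg_mul, ← Matrix.mul_neg, Matrix.diagonal_neg]
      congr 3
      funext a
      simp
    rw [h3]
    refine (Matrix.PosSemidef.diagonal fun a => ?_).mul_mul_conjTranspose_same U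
    have := hle a
    simp only [Pi.zero_apply]
    exact_mod_cast neg_nonneg.2 this
  · left
    rw [hη.posDef_iff_eigenvalues_pos]
    exact fun a => (hWmem a).1 (h ▸ Submodule.mem_top)

theorem posDef_or_neg_posDef_of_gksl_eq_zero
    (hK : K + K.conjTranspose = ∑ k, (J k).conjTranspose * J k) (hJ : IsIrreducibleFamily J)
    {η : Matrix (Fin q) (Fin q) ℂ} (hη : η.IsHermitian) (hη0 : gksl K J η = 0) (hne : η ≠ 0) :
    η.PosDef ∨ (-η).PosDef := by
  have h1 := posDef_or_neg_posSemidef_of_gksl_eq_zero hK hJ hη hη0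
  have h2 := posDef_or_neg_posSemidef_of_gksl_eq_zero hK hJ hη.neg
    (by rw [map_neg, hη0, neg_zero])
  rw [neg_neg] at h2
  rcases h1 with h1 | h1
  · exact Or.inl h1
  rcases h2 with h2 | h2
  · exact Or.inr h2
  refine absurd (h2.trace_eq_zero_iff.1 (le_antisymm ?_ h2.trace_nonneg)) hne
  have := h1.trace_nonneg
  rwa [Matrix.trace_neg, Left.nonneg_neg_iff] at this

theorem eq_zero_of_gksl_eq_zero_of_trace_eq_zero
    (hK : K + K.conjTranspose = ∑ k, (J k).conjTranspose * J k) (hJ : IsIrreducibleFamily J)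
    {η : Matrix (Fin q) (Fin q) ℂ} (hη : η.IsHermitian) (hη0 : gksl K J η = 0)
    (htr : η.trace = 0) : η = 0 := by
  by_contra hne
  have : NeZero q := ⟨hJ.1.ne'⟩
  rcases posDef_or_neg_posDef_of_gksl_eq_zero hK hJ hη hη0 hne with h | h
  · exact h.trace_pos.ne' htr
  · refine h.trace_pos.ne' ?_
    rw [Matrix.trace_neg, htr, neg_zero]

/-- The generator is traceless, hence not surjective, hence has a kernel, which contains a nonzero
Hermitian operator because it is closed under adjoints. That operator is definite. -/
theorem exists_posDef_stationary_state
    (hK : K + K.conjTranspose = ∑ k, (J k).conjTranspose * J k) (hJ : IsIrreducibleFamily J) :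
    ∃ ρ : Matrix (Fin q) (Fin q) ℂ, ρ.PosDef ∧ ρ.trace = 1 ∧ gksl K J ρ = 0 := by
  have : NeZero q := ⟨hJ.1.ne'⟩
  have hninj : ¬ Function.Injective (gksl K J) := by
    intro hinj
    obtain ⟨ρ, hρ⟩ := LinearMap.injective_iff_surjective.1 hinj 1
    have h1 := trace_gksl hK ρ
    rw [hρ, Matrix.trace_one, Fintype.card_fin] at h1
    exact hJ.1.ne' (Nat.cast_eq_zero.1 h1)
  obtain ⟨ζ, hζ, hζ0⟩ : ∃ ζ, gksl K J ζ = 0 ∧ ζ ≠ 0 := by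
    by_contra! hc
    exact hninj ((injective_iff_map_eq_zero _).2 hc)
  obtain ⟨η, hη, hη0, hne⟩ : ∃ η, η.IsHermitian ∧ gksl K J η = 0 ∧ η ≠ 0 := by
    have hζ' : gksl K J ζ.conjTranspose = 0 := by
      rw [gksl_conjTranspose, hζ, Matrix.conjTranspose_zero]
    by_cases h : ζ + ζ.conjTranspose = 0
    · refine ⟨Complex.I • ζ, ?_, by rw [map_smul, hζ, smul_zero], by simpa using hζ0⟩
      rw [Matrix.IsHermitian, Matrix.conjTranspose_smul, Complex.star_def, Complex.conj_I,
        eq_neg_of_add_eq_zero_right h, neg_smul, smul_neg, neg_neg]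
    · refine ⟨_, ?_, by rw [map_add, hζ, hζ', add_zero], h⟩
      rw [Matrix.IsHermitian, Matrix.conjTranspose_add, Matrix.conjTranspose_conjTranspose,
        add_comm]
  obtain ⟨θ, hθ, hθ0⟩ : ∃ θ, θ.PosDef ∧ gksl K J θ = 0 := by
    rcases posDef_or_neg_posDef_of_gksl_eq_zero hK hJ hη hη0 hne with h | h
    · exact ⟨η, h, hη0⟩
    · exact ⟨-η, h, by rw [map_neg, hη0, neg_zero]⟩
  have htr := hθ.trace_pos
  refine ⟨θ.trace⁻¹ • θ, hθ.smul (inv_pos.2 htr), ?_, by rw [map_smul, hθ0, smul_zero]⟩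
  rw [Matrix.trace_smul, smul_eq_mul, inv_mul_cancel₀ htr.ne']

end Irreducible

/-! ### Operators in a Schur basis -/

namespace SchurBasis

variable {m : Type} [Fintype m] [DecidableEq m] {κ : Type} {X : κ → Matrix m m ℂ}
  {L : Type} [Fintype L] [DecidableEq L] (S : SchurBasis X L)

theorem directSum_mul (A B : ∀ l, Matrix (Fin (S.mult l) × Fin (S.dim l))
    (Fin (S.mult l) × Fin (S.dim l)) ℂ) :
    S.directSum A * S.directSum B = S.directSum fun l => A l * B l := by
  unfold directSum
  rw [Matrix.blockDiagonal'_mul]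
  calc _ = S.U * Matrix.blockDiagonal' A * (S.U.conjTranspose * S.U) * Matrix.blockDiagonal' B *
        S.U.conjTranspose := by simp only [Matrix.mul_assoc]
    _ = _ := by rw [S.conjTranspose_mul, Matrix.mul_one]; simp only [Matrix.mul_assoc]

theorem directSum_conjTranspose (A : ∀ l, Matrix (Fin (S.mult l) × Fin (S.dim l))
    (Fin (S.mult l) × Fin (S.dim l)) ℂ) :
    (S.directSum A).conjTranspose = S.directSum fun l => (A l).conjTranspose := by
  simp [directSum, Matrix.blockDiagonal'_conjTranspose, Matrix.mul_assoc]

theorem conjTranspose_mul_directSum_mul (A : ∀ l, Matrix (Fin (S.mult l) × Fin (S.dim l))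
    (Fin (S.mult l) × Fin (S.dim l)) ℂ) :
    S.U.conjTranspose * S.directSum A * S.U = Matrix.blockDiagonal' A := by
  unfold directSum
  calc _ = (S.U.conjTranspose * S.U) * Matrix.blockDiagonal' A * (S.U.conjTranspose * S.U) := by
        simp only [Matrix.mul_assoc]
    _ = _ := by rw [S.conjTranspose_mul, Matrix.one_mul, Matrix.mul_one]

theorem eq_directSum_iff (O : Matrix m m ℂ) (A : ∀ l, Matrix (Fin (S.mult l) × Fin (S.dim l))
    (Fin (S.mult l) × Fin (S.dim l)) ℂ) :
    O = S.directSum A ↔ S.U.conjTranspose * O * S.U = Matrix.blockDiagonal' A := by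
  refine ⟨fun h => h ▸ S.conjTranspose_mul_directSum_mul A, fun h => ?_⟩
  rw [directSum, ← h]
  calc O = (S.U * S.U.conjTranspose) * O * (S.U * S.U.conjTranspose) := by
        rw [S.mul_conjTranspose, Matrix.one_mul, Matrix.mul_one]
    _ = _ := by simp only [Matrix.mul_assoc]

theorem directSum_injective : Function.Injective S.directSum := by
  intro A B h
  rw [eq_directSum_iff, conjTranspose_mul_directSum_mul] at h
  exact Matrix.blockDiagonal'_injective h

theorem directSum_add (A B : ∀ l, Matrix (Fin (S.mult l) × Fin (S.dim l))
    (Fin (S.mult l) × Fin (S.dim l)) ℂ) :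
    S.directSum A + S.directSum B = S.directSum (A + B) := by
  simp [directSum, Matrix.mul_add, Matrix.add_mul]

theorem directSum_sub (A B : ∀ l, Matrix (Fin (S.mult l) × Fin (S.dim l))
    (Fin (S.mult l) × Fin (S.dim l)) ℂ) :
    S.directSum A - S.directSum B = S.directSum (A - B) := by
  simp [directSum, Matrix.mul_sub, Matrix.sub_mul]

theorem directSum_zero : S.directSum 0 = 0 := by
  simp [directSum]

theorem directSum_sum {ι : Type} (s : Finset ι) (A : ι → ∀ l,
    Matrix (Fin (S.mult l) × Fin (S.dim l)) (Fin (S.mult l) × Fin (S.dim l)) ℂ) :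
    ∑ k ∈ s, S.directSum (A k) = S.directSum fun l => ∑ k ∈ s, A k l := by
  classical
  induction s using Finset.induction_on with
  | empty => exact S.directSum_zero.symm
  | insert k s hk ih =>
    rw [Finset.sum_insert hk, ih, directSum_add]
    congr 1
    funext l
    rw [Finset.sum_insert hk, Pi.add_apply]

theorem trace_directSum (A : ∀ l, Matrix (Fin (S.mult l) × Fin (S.dim l))
    (Fin (S.mult l) × Fin (S.dim l)) ℂ) : (S.directSum A).trace = ∑ l, (A l).trace := by
  rw [directSum, Matrix.trace_mul_comm, ← Matrix.mul_assoc, S.conjTranspose_mul, Matrix.one_mul,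
    Matrix.trace_blockDiagonal']

theorem posSemidef_directSum {A : ∀ l, Matrix (Fin (S.mult l) × Fin (S.dim l))
    (Fin (S.mult l) × Fin (S.dim l)) ℂ} (hA : ∀ l, (A l).PosSemidef) :
    (S.directSum A).PosSemidef := by
  open scoped MatrixOrder Matrix.Norms.L2Operator in
  have : ∀ l, ∃ B : Matrix (Fin (S.mult l) × Fin (S.dim l)) (Fin (S.mult l) × Fin (S.dim l)) ℂ,
      A l = B.conjTranspose * B := fun l =>
    CStarAlgebra.nonneg_iff_eq_star_mul_self.mp (hA l).nonneg
  choose B hB using this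
  have h : S.directSum A = (S.directSum B).conjTranspose * S.directSum B := by
    rw [directSum_conjTranspose, directSum_mul]
    exact congrArg _ (funext hB)
  rw [h]
  exact Matrix.posSemidef_conjTranspose_mul_self _

theorem posSemidef_of_directSum {A : ∀ l, Matrix (Fin (S.mult l) × Fin (S.dim l))
    (Fin (S.mult l) × Fin (S.dim l)) ℂ} (hA : (S.directSum A).PosSemidef) (l : L) :
    (A l).PosSemidef := by
  have h1 := hA.conjTranspose_mul_mul_same S.U
  rw [conjTranspose_mul_directSum_mul] at h1
  have h2 := h1.submatrix (fun j : Fin (S.mult l) × Fin (S.dim l) =>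
    (⟨l, j⟩ : Σ l, Fin (S.mult l) × Fin (S.dim l)))
  convert h2 using 1
  ext i j
  rw [Matrix.submatrix_apply, Matrix.blockDiagonal'_apply_eq]

/-- The operator `⨁_l A^l ⊗ B^l`. -/
def tensor (A : ∀ l, Matrix (Fin (S.mult l)) (Fin (S.mult l)) ℂ)
    (B : ∀ l, Matrix (Fin (S.dim l)) (Fin (S.dim l)) ℂ) : Matrix m m ℂ :=
  S.directSum fun l => A l ⊗ₖ B l

theorem generator_eq_tensor (a : κ) : X a = S.tensor 1 fun l => S.irrep l a := S.decomp a

theorem tensor_one : S.tensor 1 1 = 1 := by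
  have h : (fun l => (1 : ∀ l, Matrix (Fin (S.mult l)) (Fin (S.mult l)) ℂ) l ⊗ₖ
      (1 : ∀ l, Matrix (Fin (S.dim l)) (Fin (S.dim l)) ℂ) l) = 1 := by
    funext l
    simp
  rw [tensor, h, directSum, Matrix.blockDiagonal'_one, Matrix.mul_one, S.mul_conjTranspose]

theorem tensor_mul (A A' : ∀ l, Matrix (Fin (S.mult l)) (Fin (S.mult l)) ℂ)
    (B B' : ∀ l, Matrix (Fin (S.dim l)) (Fin (S.dim l)) ℂ) :
    S.tensor A B * S.tensor A' B' = S.tensor (A * A') (B * B') := by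
  rw [tensor, tensor, directSum_mul]
  exact congrArg _ (funext fun l => (Matrix.mul_kronecker_mul _ _ _ _).symm)

theorem tensor_conjTranspose (A : ∀ l, Matrix (Fin (S.mult l)) (Fin (S.mult l)) ℂ)
    (B : ∀ l, Matrix (Fin (S.dim l)) (Fin (S.dim l)) ℂ) :
    (S.tensor A B).conjTranspose =
      S.tensor (fun l => (A l).conjTranspose) fun l => (B l).conjTranspose := by
  rw [tensor, directSum_conjTranspose]
  exact congrArg _ (funext fun l => Matrix.conjTranspose_kronecker _ _)

theorem tensor_add (A : ∀ l, Matrix (Fin (S.mult l)) (Fin (S.mult l)) ℂ)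
    (B B' : ∀ l, Matrix (Fin (S.dim l)) (Fin (S.dim l)) ℂ) :
    S.tensor A B + S.tensor A B' = S.tensor A (B + B') := by
  rw [tensor, tensor, directSum_add]
  exact congrArg _ (funext fun l => (Matrix.kronecker_add _ _ _).symm)

theorem tensor_sub (A : ∀ l, Matrix (Fin (S.mult l)) (Fin (S.mult l)) ℂ)
    (B B' : ∀ l, Matrix (Fin (S.dim l)) (Fin (S.dim l)) ℂ) :
    S.tensor A B - S.tensor A B' = S.tensor A (B - B') := by
  rw [tensor, tensor, directSum_sub]
  refine congrArg _ (funext fun l => ?_)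
  ext i j
  simp [mul_sub]

theorem tensor_sum {ι : Type} (s : Finset ι)
    (A : ∀ l, Matrix (Fin (S.mult l)) (Fin (S.mult l)) ℂ)
    (B : ι → ∀ l, Matrix (Fin (S.dim l)) (Fin (S.dim l)) ℂ) :
    ∑ k ∈ s, S.tensor A (B k) = S.tensor A fun l => ∑ k ∈ s, B k l := by
  simp only [tensor]
  rw [directSum_sum]
  refine congrArg _ (funext fun l => ?_)
  ext i j
  simp [Matrix.sum_apply, Finset.mul_sum]

theorem tensor_one_injective : Function.Injective (S.tensor 1) := by
  intro B B' h
  have h1 := S.directSum_injective h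
  funext l
  ext i j
  have h2 := congrFun (congrFun (congrFun h1 l) (⟨0, S.mult_pos l⟩, i)) (⟨0, S.mult_pos l⟩, j)
  simpa using h2

theorem tensor_eq_zero_iff (A : ∀ l, Matrix (Fin (S.mult l)) (Fin (S.mult l)) ℂ)
    (B : ∀ l, Matrix (Fin (S.dim l)) (Fin (S.dim l)) ℂ) :
    S.tensor A B = 0 ↔ ∀ l, A l = 0 ∨ B l = 0 := by
  rw [← S.directSum_zero, tensor, S.directSum_injective.eq_iff, funext_iff]
  refine forall_congr' fun l => ⟨fun h => ?_, fun h => ?_⟩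
  · by_contra! hc
    obtain ⟨i, j, hij⟩ : ∃ i j, A l i j ≠ 0 := by
      by_contra! h'
      exact hc.1 (Matrix.ext h')
    refine hc.2 (Matrix.ext fun i' j' => ?_)
    have := congrFun (congrFun h (i, i')) (j, j')
    simpa [hij] using this
  · ext i j
    rcases h with h | h <;> simp [h]

/-- The commutant of the generators is `⨁_l M(K^l) ⊗ 1`, by Schur's lemma applied to the blocks. -/
theorem exists_eq_tensor_one_of_commutes {Z : Matrix m m ℂ} (hZ : ∀ a, Z * X a = X a * Z) :
    ∃ A, Z = S.tensor A 1 := by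
  set Z' := S.U.conjTranspose * Z * S.U with hZ'
  let bl : κ → Matrix (Σ l, Fin (S.mult l) × Fin (S.dim l)) _ ℂ := fun a =>
    Matrix.blockDiagonal' fun l =>
      (1 : Matrix (Fin (S.mult l)) (Fin (S.mult l)) ℂ) ⊗ₖ S.irrep l a
  have hcomm : ∀ a, Z' * bl a = bl a * Z' := by
    intro a
    have hX : bl a = S.U.conjTranspose * X a * S.U :=
      ((S.eq_directSum_iff _ _).1 (S.decomp a)).symm
    rw [hX, hZ']
    calc _ = S.U.conjTranspose * Z * (S.U * S.U.conjTranspose) * X a * S.U := by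
          simp only [Matrix.mul_assoc]
      _ = S.U.conjTranspose * (Z * X a) * S.U := by
          rw [S.mul_conjTranspose, Matrix.mul_one]; simp only [Matrix.mul_assoc]
      _ = S.U.conjTranspose * X a * (S.U * S.U.conjTranspose) * Z * S.U := by
          rw [hZ, S.mul_conjTranspose, Matrix.mul_one]; simp only [Matrix.mul_assoc]
      _ = _ := by simp only [Matrix.mul_assoc]
  let T : ∀ l l', Fin (S.mult l) → Fin (S.mult l') → Matrix (Fin (S.dim l)) (Fin (S.dim l')) ℂ :=
    fun l l' c c' => Matrix.of fun b b' => Z' ⟨l, c, b⟩ ⟨l', c', b'⟩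
  have hT : ∀ l l' c c' a, T l l' c c' * S.irrep l' a = S.irrep l a * T l l' c c' := by
    intro l l' c c' a
    ext b b'
    have h := congrFun (congrFun (hcomm a) ⟨l, c, b⟩) ⟨l', c', b'⟩
    rw [Matrix.mul_apply, Matrix.mul_apply, Fintype.sum_sigma, Fintype.sum_sigma,
      Finset.sum_eq_single l', Finset.sum_eq_single l, Fintype.sum_prod_type,
      Fintype.sum_prod_type, Finset.sum_eq_single c', Finset.sum_eq_single c] at h
    · simpa [bl, T, Matrix.mul_apply, Matrix.blockDiagonal'_apply_eq] using h
    · intro d _ hd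
      simp [bl, Matrix.blockDiagonal'_apply_eq, Matrix.one_apply_ne hd.symm]
    · simp
    · intro d _ hd
      simp [bl, Matrix.blockDiagonal'_apply_eq, Matrix.one_apply_ne hd]
    · simp
    · intro d _ hd
      refine Finset.sum_eq_zero fun y _ => ?_
      rw [show bl a ⟨l, c, b⟩ ⟨d, y⟩ = 0 from Matrix.blockDiagonal'_apply_ne _ _ _ hd.symm,
        zero_mul]
    · simp
    · intro d _ hd
      refine Finset.sum_eq_zero fun y _ => ?_
      rw [show bl a ⟨d, y⟩ ⟨l', c', b'⟩ = 0 from Matrix.blockDiagonal'_apply_ne _ _ _ hd, mul_zero]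
    · simp
  have hoff : ∀ l l' c c', l ≠ l' → T l l' c c' = 0 := fun l l' c c' hl =>
    eq_zero_of_intertwines (S.irreducible l') (S.irreducible l)
      (S.inequivalent l' l hl.symm) (hT l l' c c')
  choose A hA using fun l c c' => exists_eq_smul_one_of_commutes (S.irreducible l) (hT l l c c')
  refine ⟨fun l => Matrix.of fun c c' => A l c c', ?_⟩
  rw [tensor, eq_directSum_iff]
  ext ⟨l, c, b⟩ ⟨l', c', b'⟩
  by_cases hl : l = l'
  · subst hl
    have h := congrFun (congrFun (hA l c c') b) b'
    rw [Matrix.blockDiagonal'_apply_eq]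
    exact h
  · rw [Matrix.blockDiagonal'_apply_ne _ _ _ hl]
    exact congrFun (congrFun (hoff l l' c c' hl) b) b'

/-- The bicommutant: operators that commute with `⨁_l M(K^l) ⊗ 1` have the form `⨁_l 1 ⊗ B^l`. -/
theorem exists_eq_one_tensor_of_commutes {O : Matrix m m ℂ}
    (hO : ∀ A, O * S.tensor A 1 = S.tensor A 1 * O) : ∃ B, O = S.tensor 1 B := by
  set O' := S.U.conjTranspose * O * S.U with hO'
  let bl : (∀ l, Matrix (Fin (S.mult l)) (Fin (S.mult l)) ℂ) →
      Matrix (Σ l, Fin (S.mult l) × Fin (S.dim l)) _ ℂ := fun A =>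
    Matrix.blockDiagonal' fun l => A l ⊗ₖ (1 : Matrix (Fin (S.dim l)) (Fin (S.dim l)) ℂ)
  have hcomm : ∀ A, O' * bl A = bl A * O' := by
    intro A
    have hX : bl A = S.U.conjTranspose * S.tensor A 1 * S.U :=
      (S.conjTranspose_mul_directSum_mul _).symm
    rw [hX, hO']
    calc _ = S.U.conjTranspose * O * (S.U * S.U.conjTranspose) * S.tensor A 1 * S.U := by
          simp only [Matrix.mul_assoc]
      _ = S.U.conjTranspose * (O * S.tensor A 1) * S.U := by
          rw [S.mul_conjTranspose, Matrix.mul_one]; simp only [Matrix.mul_assoc]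
      _ = S.U.conjTranspose * S.tensor A 1 * (S.U * S.U.conjTranspose) * O * S.U := by
          rw [hO, S.mul_conjTranspose, Matrix.mul_one]; simp only [Matrix.mul_assoc]
      _ = _ := by simp only [Matrix.mul_assoc]
  -- multiplication by a matrix unit of `M(K^l)` moves one block of `O'` to another
  have hright : ∀ l (c c' : Fin (S.mult l)) (x) (b),
      (O' * bl (Pi.single l (Matrix.single c c' 1))) x ⟨l, c', b⟩ = O' x ⟨l, c, b⟩ := by
    intro l c c' x b
    rw [Matrix.mul_apply, Finset.sum_eq_single ⟨l, c, b⟩]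
    · simp [bl, Matrix.blockDiagonal'_apply_eq]
    · rintro ⟨l', d, b'⟩ _ hne
      by_cases hl : l' = l
      · subst hl
        have : ¬ (c = d ∧ b' = b) := by
          rintro ⟨rfl, rfl⟩
          exact hne rfl
        rw [not_and_or] at this
        rcases this with h | h <;> simp [bl, Matrix.blockDiagonal'_apply_eq, h]
      · rw [show bl _ ⟨l', d, b'⟩ ⟨l, c', b⟩ = 0 from Matrix.blockDiagonal'_apply_ne _ _ _ hl,
          mul_zero]
    · simp
  have hleft : ∀ l (c c' : Fin (S.mult l)) (b) (y),
      (bl (Pi.single l (Matrix.single c c' 1)) * O') ⟨l, c, b⟩ y = O' ⟨l, c', b⟩ y := by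
    intro l c c' b y
    rw [Matrix.mul_apply, Finset.sum_eq_single ⟨l, c', b⟩]
    · simp [bl, Matrix.blockDiagonal'_apply_eq]
    · rintro ⟨l', d, b'⟩ _ hne
      by_cases hl : l' = l
      · subst hl
        have : ¬ (c' = d ∧ b = b') := by
          rintro ⟨rfl, rfl⟩
          exact hne rfl
        rw [not_and_or] at this
        rcases this with h | h <;> simp [bl, Matrix.blockDiagonal'_apply_eq, Matrix.one_apply, h]
      · rw [show bl _ ⟨l, c, b⟩ ⟨l', d, b'⟩ = 0 from
          Matrix.blockDiagonal'_apply_ne _ _ _ (Ne.symm hl), zero_mul]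
    · simp
  have hleft0 : ∀ l (c c' : Fin (S.mult l)) (l' : L) (d : Fin (S.mult l')) (b) (y),
      (¬ ∃ h : l' = l, h ▸ d = c) →
      (bl (Pi.single l (Matrix.single c c' 1)) * O') ⟨l', d, b⟩ y = 0 := by
    intro l c c' l' d b y hne
    rw [Matrix.mul_apply]
    refine Finset.sum_eq_zero ?_
    rintro ⟨l'', d', b'⟩ _
    by_cases hl'' : l' = l''
    · subst hl''
      by_cases hl : l' = l
      · subst hl
        have : c ≠ d := fun h => hne ⟨rfl, h.symm⟩
        simp [bl, Matrix.blockDiagonal'_apply_eq, this]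
      · simp [bl, Matrix.blockDiagonal'_apply_eq, hl]
    · rw [show bl _ ⟨l', d, b⟩ ⟨l'', d', b'⟩ = 0 from
        Matrix.blockDiagonal'_apply_ne _ _ _ hl'', zero_mul]
  refine ⟨fun l => Matrix.of fun b b' =>
    O' ⟨l, ⟨0, S.mult_pos l⟩, b⟩ ⟨l, ⟨0, S.mult_pos l⟩, b'⟩, ?_⟩
  rw [tensor, eq_directSum_iff]
  ext ⟨l', d, b'⟩ ⟨l, c, b⟩
  rw [← hO', ← hright l c ⟨0, S.mult_pos l⟩, hcomm]
  by_cases hl : l' = l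
  · subst hl
    rw [Matrix.blockDiagonal'_apply_eq]
    by_cases hd : d = c
    · subst hd
      rw [hleft]
      simp
    · rw [hleft0 _ _ _ _ _ _ _ fun ⟨_, h⟩ => hd h]
      simp [hd]
  · rw [hleft0 _ _ _ _ _ _ _ fun ⟨h, _⟩ => hl h, Matrix.blockDiagonal'_apply_ne _ _ _ hl]

end SchurBasis

theorem posSemidef_left_of_kronecker {p q : ℕ} {A : Matrix (Fin p) (Fin p) ℂ}
    {B : Matrix (Fin q) (Fin q) ℂ} (hB : B.PosDef) (hq : 0 < q) (h : (A ⊗ₖ B).PosSemidef) :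
    A.PosSemidef := by
  let o : Fin q := ⟨0, hq⟩
  have hpos : 0 < B o o := hB.diag_pos
  have h1 := (h.submatrix fun i : Fin p => (i, o)).smul (inv_pos.2 hpos).le
  convert h1 using 1
  ext i j
  simp only [Matrix.smul_apply, Matrix.submatrix_apply, Matrix.kroneckerMap_apply, smul_eq_mul]
  rw [mul_comm (A i j), ← mul_assoc, inv_mul_cancel₀ hpos.ne', one_mul]

/-! ### Steady states in a Schur basis -/

section SteadyStates

variable {m : Type} [Fintype m] [DecidableEq m] {κ : Type} {X : κ → Matrix m m ℂ}
  {L : Type} [Fintype L] [DecidableEq L] {ι : Type}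

theorem SchurBasis.gksl_tensor [Fintype ι] (S : SchurBasis X L)
    (K : ∀ l, Matrix (Fin (S.dim l)) (Fin (S.dim l)) ℂ)
    (J : ι → ∀ l, Matrix (Fin (S.dim l)) (Fin (S.dim l)) ℂ)
    (A : ∀ l, Matrix (Fin (S.mult l)) (Fin (S.mult l)) ℂ)
    (B : ∀ l, Matrix (Fin (S.dim l)) (Fin (S.dim l)) ℂ) :
    gksl (S.tensor 1 K) (fun k => S.tensor 1 (J k)) (S.tensor A B) =
      S.tensor A fun l => gksl (K l) (fun k => J k l) (B l) := by
  have h1 : (fun l => ((1 : ∀ l, Matrix (Fin (S.mult l)) (Fin (S.mult l)) ℂ) l).conjTranspose)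
      = 1 := funext fun l => Matrix.conjTranspose_one
  simp only [gksl_apply, S.tensor_conjTranspose, h1, S.tensor_mul, one_mul, mul_one, S.tensor_sum,
    S.tensor_sub]
  rfl

theorem mul_comm_of_mem_adjoin {s : Set (Matrix m m ℂ)} {Z O : Matrix m m ℂ}
    (hZ : ∀ x ∈ s, Z * x = x * Z) (hO : O ∈ Algebra.adjoin ℂ s) : Z * O = O * Z := by
  have h : Algebra.adjoin ℂ s ≤ Subalgebra.centralizer ℂ {Z} := Algebra.adjoin_le fun x hx => by
    rw [SetLike.mem_coe, Subalgebra.mem_centralizer_iff]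
    rintro _ rfl
    exact hZ x hx
  exact (Subalgebra.mem_centralizer_iff ℂ).1 (h hO) Z rfl

/-- If operators `⨁_l 1 ⊗ J^l` generate an algebra containing the generators of the Schur basis,
then on each `H^l` the blocks `J^l` act irreducibly. -/
theorem SchurBasis.isIrreducibleFamily_of_mem_adjoin (S : SchurBasis X L)
    (J : ι → ∀ l, Matrix (Fin (S.dim l)) (Fin (S.dim l)) ℂ)
    (hX : ∀ a, X a ∈ Algebra.adjoin ℂ (Set.range fun k => S.tensor 1 (J k))) (l : L) :
    IsIrreducibleFamily fun k => J k l := by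
  refine ⟨(S.irreducible l).1, fun W hW => (S.irreducible l).2 W fun a => ?_⟩
  have key : ∀ O ∈ Algebra.adjoin ℂ (Set.range fun k => S.tensor 1 (J k)),
      ∃ B, O = S.tensor 1 B ∧ ∀ v ∈ W, (B l).mulVec v ∈ W := by
    have hscalar : ∀ c : ℂ, algebraMap ℂ (Matrix m m ℂ) c =
        S.tensor 1 fun l => c • (1 : Matrix (Fin (S.dim l)) (Fin (S.dim l)) ℂ) := by
      intro c
      rw [Algebra.algebraMap_eq_smul_one, ← S.tensor_one, SchurBasis.tensor, SchurBasis.tensor,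
        SchurBasis.directSum, SchurBasis.directSum, ← Matrix.smul_mul, ← Matrix.mul_smul,
        ← Matrix.blockDiagonal'_smul]
      congr 3
      funext l
      simp [Matrix.kronecker_smul]
    intro O hO
    induction hO using Algebra.adjoin_induction with
    | mem x hx =>
      obtain ⟨k, rfl⟩ := hx
      exact ⟨J k, rfl, hW k⟩
    | algebraMap c =>
      refine ⟨_, hscalar c, fun v hv => ?_⟩
      rw [Matrix.smul_mulVec, Matrix.one_mulVec]
      exact W.smul_mem c hv
    | add x y _ _ hx hy =>
      obtain ⟨B, rfl, hB⟩ := hx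
      obtain ⟨B', rfl, hB'⟩ := hy
      refine ⟨B + B', S.tensor_add _ _ _, fun v hv => ?_⟩
      rw [Pi.add_apply, Matrix.add_mulVec]
      exact W.add_mem (hB v hv) (hB' v hv)
    | mul x y _ _ hx hy =>
      obtain ⟨B, rfl, hB⟩ := hx
      obtain ⟨B', rfl, hB'⟩ := hy
      refine ⟨B * B', by rw [S.tensor_mul, one_mul], fun v hv => ?_⟩
      rw [Pi.mul_apply, ← Matrix.mulVec_mulVec]
      exact hB _ (hB' v hv)
  obtain ⟨B, hB, hBW⟩ := key (X a) (hX a)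
  rw [S.generator_eq_tensor a] at hB
  rw [show S.irrep l a = B l from congrFun (S.tensor_one_injective hB) l]
  exact hBW

theorem SchurBasis.isDensity_directSum (S : SchurBasis X L)
    {ρ : ∀ l, Matrix (Fin (S.dim l)) (Fin (S.dim l)) ℂ} (hρ : ∀ l, IsDensity (ρ l))
    {p : L → ℝ} (hp : ∀ l, 0 ≤ p l) (hp1 : ∑ l, p l = 1)
    {σ : ∀ l, Matrix (Fin (S.mult l)) (Fin (S.mult l)) ℂ} (hσ : ∀ l, IsDensity (σ l)) :
    IsDensity (S.directSum fun l => (p l : ℂ) • (σ l ⊗ₖ ρ l)) := by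
  constructor
  · refine S.posSemidef_directSum fun l => ((hσ l).1.kronecker (hρ l).1).smul ?_
    exact_mod_cast hp l
  · rw [S.trace_directSum]
    simp only [Matrix.trace_smul, Matrix.trace_kronecker, (hσ _).2, (hρ _).2, mul_one, smul_eq_mul]
    exact_mod_cast hp1

/-- A state `⨁_l A^l ⊗ ρ^l` is a mixture of states `σ^l ⊗ ρ^l`. -/
theorem SchurBasis.exists_weights_of_isDensity_tensor (S : SchurBasis X L)
    {ρ : ∀ l, Matrix (Fin (S.dim l)) (Fin (S.dim l)) ℂ} (hρ : ∀ l, (ρ l).PosDef)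
    (hρtr : ∀ l, (ρ l).trace = 1) {A : ∀ l, Matrix (Fin (S.mult l)) (Fin (S.mult l)) ℂ}
    (hη : IsDensity (S.tensor A ρ)) :
    ∃ (p : L → ℝ) (σ : ∀ l, Matrix (Fin (S.mult l)) (Fin (S.mult l)) ℂ),
      (∀ l, 0 ≤ p l) ∧ ∑ l, p l = 1 ∧ (∀ l, IsDensity (σ l)) ∧
      S.tensor A ρ = S.directSum fun l => (p l : ℂ) • (σ l ⊗ₖ ρ l) := by
  have hA : ∀ l, (A l).PosSemidef := fun l =>
    posSemidef_left_of_kronecker (hρ l) (S.irreducible l).1 (S.posSemidef_of_directSum hη.1 l)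
  have hre : ∀ l, (((A l).trace.re : ℝ) : ℂ) = (A l).trace := fun l =>
    Complex.ext rfl (Complex.nonneg_iff.1 (hA l).trace_nonneg).2
  have htr : ∑ l, (A l).trace = 1 := by
    rw [← hη.2, SchurBasis.tensor, S.trace_directSum]
    exact Finset.sum_congr rfl fun l _ => by rw [Matrix.trace_kronecker, hρtr, mul_one]
  have hσ : ∀ l, ∃ σ, IsDensity σ ∧ A l = (((A l).trace.re : ℝ) : ℂ) • σ := by
    intro l
    rw [hre]
    -- a block of weight zero vanishes, and any state serves as `σ`; here the maximally mixed one
    by_cases h : (A l).trace = 0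
    · have hne : ((S.mult l : ℕ) : ℂ) ≠ 0 := Nat.cast_ne_zero.2 (S.mult_pos l).ne'
      refine ⟨((S.mult l : ℕ) : ℂ)⁻¹ • 1, ⟨Matrix.PosSemidef.one.smul ?_, ?_⟩, ?_⟩
      · exact inv_nonneg.2 (Nat.cast_nonneg _)
      · rw [Matrix.trace_smul, Matrix.trace_one, Fintype.card_fin, smul_eq_mul,
          inv_mul_cancel₀ hne]
      · rw [h, zero_smul]
        exact (hA l).trace_eq_zero_iff.1 h
    · refine ⟨(A l).trace⁻¹ • A l, ⟨(hA l).smul (inv_nonneg.2 (hA l).trace_nonneg), ?_⟩, ?_⟩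
      · rw [Matrix.trace_smul, smul_eq_mul, inv_mul_cancel₀ h]
      · rw [smul_smul, mul_inv_cancel₀ h, one_smul]
  choose σ hσd hσA using hσ
  refine ⟨fun l => (A l).trace.re, σ, fun l => (Complex.nonneg_iff.1 (hA l).trace_nonneg).1, ?_,
    hσd, ?_⟩
  · rw [← Complex.re_sum, htr, Complex.one_re]
  · refine congrArg S.directSum (funext fun l => ?_)
    exact (congrArg (· ⊗ₖ ρ l) (hσA l)).trans (Matrix.smul_kronecker _ _ _)

/-- The steady states for jump operators that generate the algebra of the `X a`, where the jump
operators and `K` lie in the bicommutant of the `X a`. -/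
theorem SchurBasis.exists_steady_states [Fintype ι] (S : SchurBasis X L) {K : Matrix m m ℂ}
    {J : ι → Matrix m m ℂ} (hK : K + K.conjTranspose = ∑ k, (J k).conjTranspose * J k)
    (hKX : ∀ Z, (∀ a, Z * X a = X a * Z) → Z * K = K * Z)
    (hJX : ∀ Z, (∀ a, Z * X a = X a * Z) → ∀ k, Z * J k = J k * Z)
    (hX : ∀ a, X a ∈ Algebra.adjoin ℂ (Set.range J)) :
    ∃ ρ : ∀ l, Matrix (Fin (S.dim l)) (Fin (S.dim l)) ℂ,
      (∀ l, IsDensity (ρ l)) ∧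
      (∀ (l : L) (σ : Matrix (Fin (S.mult l)) (Fin (S.mult l)) ℂ)
          (θ : Matrix (Fin (S.dim l)) (Fin (S.dim l)) ℂ), IsDensity σ → IsDensity θ →
          (gksl K J (S.directSum (Pi.single l (σ ⊗ₖ θ))) = 0 ↔ θ = ρ l)) ∧
      ∀ η : Matrix m m ℂ, (IsDensity η ∧ gksl K J η = 0) ↔
        ∃ (p : L → ℝ) (σ : ∀ l, Matrix (Fin (S.mult l)) (Fin (S.mult l)) ℂ),
          (∀ l, 0 ≤ p l) ∧ ∑ l, p l = 1 ∧ (∀ l, IsDensity (σ l)) ∧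
          η = S.directSum fun l => (p l : ℂ) • (σ l ⊗ₖ ρ l) := by
  have hcommX : ∀ A a, S.tensor A 1 * X a = X a * S.tensor A 1 := by
    intro A a
    rw [S.generator_eq_tensor a, S.tensor_mul, S.tensor_mul, mul_one, one_mul, one_mul, mul_one]
  obtain ⟨K', rfl⟩ := S.exists_eq_one_tensor_of_commutes (O := K)
    fun A => (hKX _ (hcommX A)).symm
  choose J' hJ' using fun k => S.exists_eq_one_tensor_of_commutes (O := J k)
    fun A => (hJX _ (hcommX A) k).symm
  obtain rfl : J = fun k => S.tensor 1 (J' k) := funext hJ'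
  have hK' : ∀ l, K' l + (K' l).conjTranspose = ∑ k, (J' k l).conjTranspose * J' k l := by
    have h1 : (fun l => ((1 : ∀ l, Matrix (Fin (S.mult l)) (Fin (S.mult l)) ℂ) l).conjTranspose)
        = 1 := funext fun l => Matrix.conjTranspose_one
    simp only [S.tensor_conjTranspose, h1, S.tensor_mul, one_mul, S.tensor_add, S.tensor_sum] at hK
    exact fun l => congrFun (S.tensor_one_injective hK) l
  have hirr := S.isIrreducibleFamily_of_mem_adjoin J' hX
  choose ρ hρ hρtr hρ0 using fun l => exists_posDef_stationary_state (hK' l) (hirr l)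
  have hρfun : ∀ A, gksl (S.tensor 1 K') (fun k => S.tensor 1 (J' k)) (S.tensor A ρ) = 0 := by
    intro A
    rw [S.gksl_tensor, S.tensor_eq_zero_iff]
    exact fun l => Or.inr (hρ0 l)
  have hunique : ∀ l (θ : Matrix (Fin (S.dim l)) (Fin (S.dim l)) ℂ), IsDensity θ →
      gksl (K' l) (fun k => J' k l) θ = 0 → θ = ρ l := by
    intro l θ hθ hθ0
    refine sub_eq_zero.1 (eq_zero_of_gksl_eq_zero_of_trace_eq_zero (hK' l) (hirr l)
      (hθ.1.1.sub (hρ l).1) ?_ ?_)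
    · rw [map_sub, hθ0, hρ0, sub_zero]
    · rw [Matrix.trace_sub, hθ.2, hρtr, sub_self]
  refine ⟨ρ, fun l => ⟨(hρ l).posSemidef, hρtr l⟩, fun l σ θ hσ hθ => ?_, fun η => ⟨?_, ?_⟩⟩
  · have h1 : S.directSum (Pi.single l (σ ⊗ₖ θ)) =
        S.tensor (Pi.single l σ) (Function.update ρ l θ) := by
      refine congrArg _ (funext fun l' => ?_)
      by_cases h : l' = l
      · subst h; simp
      · simp [h]
    rw [h1]
    constructor
    · intro h
      rw [S.gksl_tensor, S.tensor_eq_zero_iff] at h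
      have h2 := h l
      rw [Pi.single_eq_same, Function.update_self] at h2
      refine hunique l θ hθ (h2.resolve_left ?_)
      rintro rfl
      simpa using hσ.2
    · rintro rfl
      rw [Function.update_eq_self]
      exact hρfun _
  · rintro ⟨hη, hη0⟩
    -- `⨁_l 1 ⊗ ρ^l` is a positive definite stationary operator on the whole space
    have hρpos : (S.tensor 1 ρ).PosDef := by
      refine (S.posSemidef_directSum fun l =>
        Matrix.PosSemidef.one.kronecker (hρ l).posSemidef).posDef_iff_isUnit.2 ?_
      refine IsUnit.of_mul_eq_one (S.tensor 1 fun l => (ρ l)⁻¹) ?_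
      change S.tensor 1 ρ * _ = 1
      rw [S.tensor_mul, one_mul, ← S.tensor_one]
      refine congrArg _ (funext fun l => ?_)
      exact Matrix.mul_nonsing_inv _ ((Matrix.isUnit_iff_isUnit_det _).1 (hρ l).isUnit)
    obtain ⟨Z, rfl, hZ⟩ := exists_commuting_of_gksl_eq_zero hK hρpos (hρfun 1) hη0
    obtain ⟨A, rfl⟩ := S.exists_eq_tensor_one_of_commutes fun a =>
      mul_comm_of_mem_adjoin (by rintro _ ⟨k, rfl⟩; exact hZ k) (hX a)
    rw [S.tensor_mul, mul_one, one_mul] at hη ⊢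
    exact S.exists_weights_of_isDensity_tensor hρ hρtr hη
  · rintro ⟨p, σ, hp, hp1, hσ, rfl⟩
    refine ⟨S.isDensity_directSum (fun l => ⟨(hρ l).posSemidef, hρtr l⟩) hp hp1 hσ, ?_⟩
    have h1 : S.directSum (fun l => (p l : ℂ) • (σ l ⊗ₖ ρ l)) =
        S.tensor (fun l => (p l : ℂ) • σ l) ρ :=
      congrArg _ (funext fun l => (Matrix.smul_kronecker _ _ _).symm)
    rw [h1]
    exact hρfun _

end SteadyStates

/-! ### Jump operators from a rate matrix -/

section Jumps

variable {m ι : Type} [Fintype m] [Fintype ι]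

/-- The jump operators `∑_μ conj(B_{kμ}) F_μ` that put the dissipator with sources `F_μ` and rate
matrix `Γ = B† B` into diagonal form. -/
def jumpOperator (B : Matrix ι ι ℂ) (F : ι → Matrix m m ℂ) (k : ι) : Matrix m m ℂ :=
  ∑ μ, star (B k μ) • F μ

theorem sum_jumpOperator_sandwich (B : Matrix ι ι ℂ) (F : ι → Matrix m m ℂ) (ρ : Matrix m m ℂ) :
    ∑ k, jumpOperator B F k * ρ * (jumpOperator B F k).conjTranspose =
      ∑ μ, ∑ ν, (B.conjTranspose * B) μ ν • (F μ * ρ * (F ν).conjTranspose) := by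
  have h : ∀ k, jumpOperator B F k * ρ * (jumpOperator B F k).conjTranspose =
      ∑ μ, ∑ ν, (star (B k μ) * B k ν) • (F μ * ρ * (F ν).conjTranspose) := by
    intro k
    simp only [jumpOperator, Matrix.conjTranspose_sum, Matrix.conjTranspose_smul, star_star,
      Matrix.sum_mul, Matrix.mul_sum, Matrix.smul_mul, Matrix.mul_smul, Finset.smul_sum, smul_smul]
    rw [Finset.sum_comm]
    simp only [mul_comm]
  rw [Finset.sum_congr rfl fun k _ => h k, Finset.sum_comm]
  refine Finset.sum_congr rfl fun μ _ => ?_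
  rw [Finset.sum_comm]
  refine Finset.sum_congr rfl fun ν _ => ?_
  rw [← Finset.sum_smul, Matrix.mul_apply]
  rfl

theorem sum_jumpOperator_star_mul (B : Matrix ι ι ℂ) (F : ι → Matrix m m ℂ) :
    ∑ k, (jumpOperator B F k).conjTranspose * jumpOperator B F k =
      ∑ μ, ∑ ν, (B.conjTranspose * B) μ ν • ((F ν).conjTranspose * F μ) := by
  have h : ∀ k, (jumpOperator B F k).conjTranspose * jumpOperator B F k =
      ∑ μ, ∑ ν, (star (B k μ) * B k ν) • ((F ν).conjTranspose * F μ) := by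
    intro k
    simp only [jumpOperator, Matrix.conjTranspose_sum, Matrix.conjTranspose_smul, star_star,
      Matrix.sum_mul, Matrix.mul_sum, Matrix.smul_mul, Matrix.mul_smul, Finset.smul_sum, smul_smul]
  rw [Finset.sum_congr rfl fun k _ => h k, Finset.sum_comm]
  refine Finset.sum_congr rfl fun μ _ => ?_
  rw [Finset.sum_comm]
  refine Finset.sum_congr rfl fun ν _ => ?_
  rw [← Finset.sum_smul, Matrix.mul_apply]
  rfl

open Classical in
/-- The coefficient vectors of the jump operators span the range of `Γ = B† B`. If this contains the
coordinate vector of `μ`, up to entries at sources that vanish, then the source `F μ` is a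
combination of jump operators. -/
theorem mem_span_jumpOperator {B : Matrix ι ι ℂ} {F : ι → Matrix m m ℂ} {P : Set ι}
    {A : Set ι} (hA : ∀ μ, F μ ≠ 0 ↔ μ ∈ A) (h : HasFullRankOver (B.conjTranspose * B) A P) {μ : ι}
    (hμ : μ ∈ P) :
    F μ ∈ Submodule.span ℂ (Set.range (jumpOperator B F)) := by
  by_cases hF : F μ = 0
  · rw [hF]
    exact zero_mem _
  obtain ⟨x, hx⟩ := h ⟨μ, (hA μ).1 hF⟩ hμ
  have hsum : ∑ k, (∑ ν, B k (ν : A) * x ν) • jumpOperator B F k = F μ := by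
    have h1 : ∀ k, (∑ ν, B k (ν : A) * x ν) • jumpOperator B F k =
        ∑ μ', (∑ ν : A, star (B k μ') * B k ν * x ν) • F μ' := by
      intro k
      simp only [jumpOperator, Finset.smul_sum, smul_smul, Finset.sum_mul]
      refine Finset.sum_congr rfl fun μ' _ => ?_
      congr 1
      exact Finset.sum_congr rfl fun ν _ => by ring
    rw [Finset.sum_congr rfl fun k _ => h1 k, Finset.sum_comm]
    have h2 : ∀ μ', ∑ k, (∑ ν : A, star (B k μ') * B k ν * x ν) • F μ' =
        (∑ ν : A, (B.conjTranspose * B) μ' ν * x ν) • F μ' := by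
      intro μ'
      rw [← Finset.sum_smul, Finset.sum_comm]
      simp only [Matrix.mul_apply, Matrix.conjTranspose_apply, Finset.sum_mul]
    rw [Finset.sum_congr rfl fun μ' _ => h2 μ', Finset.sum_eq_single μ]
    · have := congrFun hx ⟨μ, (hA μ).1 hF⟩
      rw [Pi.single_eq_same] at this
      rw [show ∑ ν : A, (B.conjTranspose * B) μ ν * x ν = 1 by
        exact this, one_smul]
    · intro μ' _ hne
      by_cases hF' : F μ' = 0
      · rw [hF', smul_zero]
      have := congrFun hx ⟨μ', (hA μ').1 hF'⟩
      rw [Pi.single_eq_of_ne fun h => hne (congrArg Subtype.val h)] at this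
      rw [show ∑ ν : A, (B.conjTranspose * B) μ' ν * x ν = 0 by
        exact this, zero_smul]
    · simp
  rw [← hsum]
  exact Submodule.sum_mem _ fun k _ => Submodule.smul_mem _ _ (Submodule.subset_span ⟨k, rfl⟩)

end Jumps

/-! ### Bohr components -/

section Bohr

variable {m : Type} [Fintype m] [DecidableEq m] {H : Matrix m m ℂ} (hH : H.IsHermitian)

theorem conjTranspose_mul_eigenvectorUnitary :
    (hH.eigenvectorUnitary : Matrix m m ℂ).conjTranspose *
      (hH.eigenvectorUnitary : Matrix m m ℂ) = 1 := by
  rw [← Matrix.star_eq_conjTranspose]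
  exact Unitary.coe_star_mul_self _

theorem eigenvectorUnitary_mul_conjTranspose :
    (hH.eigenvectorUnitary : Matrix m m ℂ) *
      (hH.eigenvectorUnitary : Matrix m m ℂ).conjTranspose = 1 := by
  rw [← Matrix.star_eq_conjTranspose]
  exact Unitary.coe_mul_star_self _

theorem sum_bohrComponent {hbar : ℝ} (hhbar : hbar ≠ 0) (E : Matrix m m ℂ) :
    ∑ ω ∈ bohrFrequencies hH hbar, bohrComponent hH hbar ω E = E := by
  classical
  set U := (hH.eigenvectorUnitary : Matrix m m ℂ)
  have hUU : U * U.conjTranspose = 1 := eigenvectorUnitary_mul_conjTranspose hH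
  simp only [bohrComponent]
  rw [← Matrix.sum_mul, ← Matrix.mul_sum]
  have : ∑ ω ∈ bohrFrequencies hH hbar, (Matrix.of fun a b =>
      if hH.eigenvalues a - hH.eigenvalues b = hbar * ω then
        (U.conjTranspose * E * U) a b else 0) = U.conjTranspose * E * U := by
    ext a b
    rw [Matrix.sum_apply, Finset.sum_eq_single ((hH.eigenvalues a - hH.eigenvalues b) / hbar)]
    · rw [Matrix.of_apply, if_pos (mul_div_cancel₀ _ hhbar).symm]
    · intro ω _ hω
      rw [Matrix.of_apply, if_neg]
      intro h
      exact hω (by rw [h, mul_div_cancel_left₀ _ hhbar])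
    · intro h
      exact absurd (Finset.mem_image.2 ⟨(a, b), Finset.mem_univ _, rfl⟩) h
  rw [this]
  calc U * (U.conjTranspose * E * U) * U.conjTranspose
      = (U * U.conjTranspose) * E * (U * U.conjTranspose) := by simp only [Matrix.mul_assoc]
    _ = E := by rw [hUU, Matrix.one_mul, Matrix.mul_one]

/-- The Bohr components of `E` lie in the bicommutant of `H` and `E`. -/
theorem commutes_bohrComponent {hbar ω : ℝ} {E Z : Matrix m m ℂ} (hZH : Z * H = H * Z)
    (hZE : Z * E = E * Z) :
    Z * bohrComponent hH hbar ω E = bohrComponent hH hbar ω E * Z := by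
  classical
  set U := (hH.eigenvectorUnitary : Matrix m m ℂ) with hUdef
  have hUU : U * U.conjTranspose = 1 := eigenvectorUnitary_mul_conjTranspose hH
  have hU'U : U.conjTranspose * U = 1 := conjTranspose_mul_eigenvectorUnitary hH
  have key : ∀ A B : Matrix m m ℂ, (U.conjTranspose * A * U) * (U.conjTranspose * B * U) =
      U.conjTranspose * (A * B) * U := by
    intro A B
    calc (U.conjTranspose * A * U) * (U.conjTranspose * B * U)
        = U.conjTranspose * A * (U * U.conjTranspose) * B * U := by simp only [Matrix.mul_assoc]
      _ = U.conjTranspose * (A * B) * U := by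
          rw [hUU, Matrix.mul_one]; simp only [Matrix.mul_assoc]
  have hspec : H = U * Matrix.diagonal (fun a => (hH.eigenvalues a : ℂ)) * U.conjTranspose :=
    hH.spectral_theorem
  have hdiag : U.conjTranspose * H * U = Matrix.diagonal (fun a => (hH.eigenvalues a : ℂ)) := by
    conv_lhs => rw [hspec]
    calc _ = (U.conjTranspose * U) * Matrix.diagonal (fun a => (hH.eigenvalues a : ℂ)) *
          (U.conjTranspose * U) := by simp only [Matrix.mul_assoc]
      _ = _ := by rw [hU'U, Matrix.one_mul, Matrix.mul_one]
  set Z' := U.conjTranspose * Z * U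
  set E' := U.conjTranspose * E * U
  have hZE' : Z' * E' = E' * Z' := by rw [key, key, hZE]
  have hZ0 : ∀ a b, Z' a b ≠ 0 → hH.eigenvalues a = hH.eigenvalues b := by
    intro a b hab
    have h1 : Z' * Matrix.diagonal (fun a => (hH.eigenvalues a : ℂ)) =
        Matrix.diagonal (fun a => (hH.eigenvalues a : ℂ)) * Z' := by
      rw [← hdiag, key, key, hZH]
    have h2 := congrFun (congrFun h1 a) b
    rw [Matrix.mul_diagonal, Matrix.diagonal_mul, mul_comm] at h2
    exact_mod_cast (mul_right_cancel₀ hab h2).symm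
  set M : Matrix m m ℂ := Matrix.of fun a b =>
    if hH.eigenvalues a - hH.eigenvalues b = hbar * ω then E' a b else 0 with hM
  have hZM : Z' * M = M * Z' := by
    ext a b
    -- a nonzero entry of `Z'` joins equal eigenvalues, so the selection rule defining `M` reads the
    -- same on either side of it
    have h1 : (Z' * M) a b = if hH.eigenvalues a - hH.eigenvalues b = hbar * ω then
        (Z' * E') a b else 0 := by
      rw [Matrix.mul_apply, Matrix.mul_apply, Finset.sum_congr rfl fun c _ =>
        show Z' a c * M c b = if hH.eigenvalues a - hH.eigenvalues b = hbar * ω then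
          Z' a c * E' c b else 0 by
        by_cases hz : Z' a c = 0
        · simp [hz]
        · rw [hM, Matrix.of_apply, ← hZ0 a c hz, mul_ite, mul_zero]]
      split_ifs
      · rfl
      · exact Finset.sum_const_zero
    have h2 : (M * Z') a b = if hH.eigenvalues a - hH.eigenvalues b = hbar * ω then
        (E' * Z') a b else 0 := by
      rw [Matrix.mul_apply, Matrix.mul_apply, Finset.sum_congr rfl fun c _ =>
        show M a c * Z' c b = if hH.eigenvalues a - hH.eigenvalues b = hbar * ω then
          E' a c * Z' c b else 0 by
        by_cases hz : Z' c b = 0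
        · simp [hz]
        · rw [hM, Matrix.of_apply, hZ0 c b hz, ite_mul, zero_mul]]
      split_ifs
      · rfl
      · exact Finset.sum_const_zero
    rw [h1, h2, hZE']
  have hb : bohrComponent hH hbar ω E = U * M * U.conjTranspose := rfl
  have hZ : Z = U * Z' * U.conjTranspose := by
    calc Z = (U * U.conjTranspose) * Z * (U * U.conjTranspose) := by
          rw [hUU, Matrix.one_mul, Matrix.mul_one]
      _ = _ := by simp only [Z', Matrix.mul_assoc]
  have key' : ∀ A B : Matrix m m ℂ, (U * A * U.conjTranspose) * (U * B * U.conjTranspose) =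
      U * (A * B) * U.conjTranspose := by
    intro A B
    calc (U * A * U.conjTranspose) * (U * B * U.conjTranspose)
        = U * A * (U.conjTranspose * U) * B * U.conjTranspose := by simp only [Matrix.mul_assoc]
      _ = _ := by
          rw [hU'U, Matrix.mul_one]; simp only [Matrix.mul_assoc]
  rw [hb, hZ, key', key', hZM]

end Bohr

/-! ### The Lindblad generator -/

section Main

variable {m : Type} [Fintype m] [DecidableEq m] {H : Matrix m m ℂ} {ι : Type} [Fintype ι]

/-- The Lindblad generator in diagonal form, with jump operators indexed by the Bohr frequencies and
the rows of the factors `B ω` of `Γ ω = (B ω)† B ω`. -/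
theorem exists_gksl_eq_lindblad (hH : H.IsHermitian) (hbar : ℝ) (E : ι → Matrix m m ℂ)
    {Γ : ℝ → Matrix ι ι ℂ} (hΓ : ∀ ω ∈ bohrFrequencies hH hbar, (Γ ω).PosSemidef) :
    ∃ B : bohrFrequencies hH hbar → Matrix ι ι ℂ,
      (∀ ω : bohrFrequencies hH hbar, Γ ω = (B ω).conjTranspose * B ω) ∧
      ∀ J : bohrFrequencies hH hbar × ι → Matrix m m ℂ,
        (∀ j, J j = jumpOperator (B j.1) (fun μ => bohrComponent hH hbar j.1 (E μ)) j.2) →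
        lindblad hH hbar E Γ = gksl ((Complex.I / (hbar : ℂ)) • H +
          (1 / 2 : ℂ) • ∑ j, (J j).conjTranspose * J j) J := by
  open scoped MatrixOrder Matrix.Norms.L2Operator in
  have : ∀ ω : bohrFrequencies hH hbar, ∃ B : Matrix ι ι ℂ, Γ ω = B.conjTranspose * B := by
    classical
    exact fun ω => CStarAlgebra.nonneg_iff_eq_star_mul_self.mp (hΓ ω ω.2).nonneg
  choose B hB using this
  refine ⟨B, hB, fun J hJ => ?_⟩
  funext ρ
  have hK : ((Complex.I / (hbar : ℂ)) • H + (1 / 2 : ℂ) •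
      ∑ j, (J j).conjTranspose * J j).conjTranspose =
      -((Complex.I / (hbar : ℂ)) • H) + (1 / 2 : ℂ) • ∑ j, (J j).conjTranspose * J j := by
    rw [Matrix.conjTranspose_add, Matrix.conjTranspose_smul, Matrix.conjTranspose_smul, hH.eq,
      Matrix.conjTranspose_sum]
    simp [neg_div]
  have h1 : ∑ j, J j * ρ * (J j).conjTranspose = ∑ ω ∈ bohrFrequencies hH hbar, ∑ μ, ∑ ν, Γ ω μ ν •
      (bohrComponent hH hbar ω (E μ) * ρ * (bohrComponent hH hbar ω (E ν)).conjTranspose) := by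
    rw [Fintype.sum_prod_type]
    refine Eq.trans ?_ (Finset.sum_coe_sort (bohrFrequencies hH hbar) _)
    refine Finset.sum_congr rfl fun ω _ => ?_
    simp only [hJ]
    rw [sum_jumpOperator_sandwich, ← hB]
  have h2 : ∑ j, (J j).conjTranspose * J j = ∑ ω ∈ bohrFrequencies hH hbar, ∑ μ, ∑ ν, Γ ω μ ν •
      ((bohrComponent hH hbar ω (E ν)).conjTranspose * bohrComponent hH hbar ω (E μ)) := by
    rw [Fintype.sum_prod_type]
    refine Eq.trans ?_ (Finset.sum_coe_sort (bohrFrequencies hH hbar) _)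
    refine Finset.sum_congr rfl fun ω _ => ?_
    simp only [hJ]
    rw [sum_jumpOperator_star_mul, ← hB]
  rw [gksl_apply, hK, h1, h2, lindblad]
  have h3 : ∑ ω ∈ bohrFrequencies hH hbar, ∑ μ, ∑ ν, Γ ω μ ν •
      (bohrComponent hH hbar ω (E μ) * ρ * (bohrComponent hH hbar ω (E ν)).conjTranspose -
        (1 / 2 : ℂ) •
          ((bohrComponent hH hbar ω (E ν)).conjTranspose * bohrComponent hH hbar ω (E μ) * ρ +
            ρ * ((bohrComponent hH hbar ω (E ν)).conjTranspose *
              bohrComponent hH hbar ω (E μ)))) =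
      (∑ ω ∈ bohrFrequencies hH hbar, ∑ μ, ∑ ν, Γ ω μ ν •
        (bohrComponent hH hbar ω (E μ) * ρ * (bohrComponent hH hbar ω (E ν)).conjTranspose)) -
      (1 / 2 : ℂ) • ((∑ ω ∈ bohrFrequencies hH hbar, ∑ μ, ∑ ν, Γ ω μ ν •
        ((bohrComponent hH hbar ω (E ν)).conjTranspose * bohrComponent hH hbar ω (E μ))) * ρ +
        ρ * ∑ ω ∈ bohrFrequencies hH hbar, ∑ μ, ∑ ν, Γ ω μ ν •
        ((bohrComponent hH hbar ω (E ν)).conjTranspose * bohrComponent hH hbar ω (E μ))) := by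
    simp only [Finset.smul_sum, Matrix.sum_mul, Matrix.mul_sum, Matrix.smul_mul, Matrix.mul_smul,
      ← Finset.sum_add_distrib, ← Finset.sum_sub_distrib, ← smul_add]
    refine Finset.sum_congr rfl fun ω _ => Finset.sum_congr rfl fun μ _ =>
      Finset.sum_congr rfl fun ν _ => ?_
    rw [smul_sub, smul_comm (1 / 2 : ℂ)]
  rw [h3]
  generalize (∑ ω ∈ bohrFrequencies hH hbar, ∑ μ, ∑ ν, Γ ω μ ν •
        ((bohrComponent hH hbar ω (E ν)).conjTranspose * bohrComponent hH hbar ω (E μ))) = D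
  simp only [Matrix.add_mul, Matrix.mul_add, Matrix.smul_mul, Matrix.mul_smul, Matrix.mul_neg]
  module

/-- The steady states for Hermitian operators `X a` and jump sources `E μ` in the algebra they
generate, when the sources with index in `P`, over which the rates have full rank, generate the
`X a`. -/
theorem steadyStatesHaveSchurForm_lindblad (hH : H.IsHermitian) {hbar : ℝ} (hhbar : hbar ≠ 0)
    {κ : Type} {X : κ → Matrix m m ℂ} (hX : ∀ a, (X a).IsHermitian) {E : ι → Matrix m m ℂ}
    {Γ : ℝ → Matrix ι ι ℂ} {P : Set ι} (hHX : H ∈ Algebra.adjoin ℂ (Set.range X))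
    (hEX : ∀ μ, E μ ∈ Algebra.adjoin ℂ (Set.range X))
    (hXE : ∀ a, X a ∈ Algebra.adjoin ℂ (E '' P))
    (hΓ : ∀ ω ∈ bohrFrequencies hH hbar, (Γ ω).PosSemidef ∧
      HasFullRankOver (Γ ω) {μ | bohrComponent hH hbar ω (E μ) ≠ 0} P) :
    SteadyStatesHaveSchurForm X (lindblad hH hbar E Γ) := by
  refine ⟨exists_schurBasis X hX, ?_⟩
  intro L _ _ S
  obtain ⟨B, hB, hlin⟩ := exists_gksl_eq_lindblad hH hbar E fun ω hω => (hΓ ω hω).1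
  let J : bohrFrequencies hH hbar × ι → Matrix m m ℂ := fun j =>
    jumpOperator (B j.1) (fun μ => bohrComponent hH hbar j.1 (E μ)) j.2
  rw [hlin J fun _ => rfl]
  have hcomm : ∀ {Z : Matrix m m ℂ}, (∀ a, Z * X a = X a * Z) →
      ∀ {O}, O ∈ Algebra.adjoin ℂ (Set.range X) → Z * O = O * Z := by
    intro Z hZ O hO
    exact mul_comm_of_mem_adjoin (by rintro _ ⟨a, rfl⟩; exact hZ a) hO
  have hJ : ∀ Z, (∀ a, Z * X a = X a * Z) → ∀ j, Z * J j = J j * Z := by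
    intro Z hZ j
    simp only [J, jumpOperator, Matrix.mul_sum, Matrix.sum_mul, Matrix.mul_smul, Matrix.smul_mul]
    refine Finset.sum_congr rfl fun μ _ => ?_
    rw [commutes_bohrComponent hH (hcomm hZ hHX) (hcomm hZ (hEX μ))]
  have hJ' : ∀ Z, (∀ a, Z * X a = X a * Z) → ∀ j,
      Z * (J j).conjTranspose = (J j).conjTranspose * Z := by
    intro Z hZ j
    have h1 : ∀ a, Z.conjTranspose * X a = X a * Z.conjTranspose := by
      intro a
      have := congrArg Matrix.conjTranspose (hZ a)
      rw [Matrix.conjTranspose_mul, Matrix.conjTranspose_mul, (hX a).eq] at this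
      exact this.symm
    have := congrArg Matrix.conjTranspose (hJ _ h1 j)
    rw [Matrix.conjTranspose_mul, Matrix.conjTranspose_mul, Matrix.conjTranspose_conjTranspose]
      at this
    exact this.symm
  refine S.exists_steady_states ?_ (fun Z hZ => ?_) hJ fun a => ?_
  · have hs : (∑ j, (J j).conjTranspose * J j).conjTranspose = ∑ j, (J j).conjTranspose * J j := by
      simp [Matrix.conjTranspose_sum]
    rw [Matrix.conjTranspose_add, Matrix.conjTranspose_smul, Matrix.conjTranspose_smul, hH.eq, hs]
    have h1 : star (Complex.I / (hbar : ℂ)) = -(Complex.I / (hbar : ℂ)) := by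
      simp [neg_div]
    have h2 : star (1 / 2 : ℂ) = 1 / 2 := by simp
    rw [h1, h2]
    module
  · simp only [Matrix.mul_add, Matrix.add_mul, Matrix.mul_smul, Matrix.smul_mul, Matrix.mul_sum,
      Matrix.sum_mul]
    rw [hcomm hZ hHX]
    congr 2
    refine Finset.sum_congr rfl fun j _ => ?_
    rw [← Matrix.mul_assoc, hJ' Z hZ, Matrix.mul_assoc, hJ Z hZ, Matrix.mul_assoc]
  · refine Algebra.adjoin_le ?_ (hXE a)
    rintro _ ⟨μ, hμ, rfl⟩
    rw [SetLike.mem_coe, ← sum_bohrComponent hH hhbar (E μ)]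
    refine sum_mem fun ω hω => ?_
    have h1 := (hΓ ω hω).2
    rw [hB ⟨ω, hω⟩] at h1
    have h2 := mem_span_jumpOperator (fun _ => Iff.rfl) h1 hμ
    refine (Submodule.span_le
      (p := Subalgebra.toSubmodule (Algebra.adjoin ℂ (Set.range J)))).2 ?_ h2
    rintro _ ⟨k, rfl⟩
    exact Algebra.subset_adjoin ⟨(⟨ω, hω⟩, k), rfl⟩

end Main

end

theorem theorem1 (n : ℕ) (hbar : ℝ) (hhbar : 0 < hbar) :
    -- ensembles of `n` particles with `d` levels, any permutation-invariant Hamiltonian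
    (∀ (d : ℕ) (H : Matrix (Fin n → Fin d) (Fin n → Fin d) ℂ) (hH : H.IsHermitian)
        (c : SuRoot d → ℂ) (Γ : ℝ → Matrix (SuRoot d) (SuRoot d) ℂ) (R : Finset (SuRoot d)),
      IsPermutationInvariant H →
      (∀ μ, c μ ≠ 0) → (∀ μ : SuRoot d, c μ.neg = star (c μ)) →
      IsSimpleRoots R →
      RatesFullRank hH hbar (fun μ => collective n (μ.gen (c μ))) Γ R →
      SteadyStatesHaveSchurForm (fun x : SuGenerator d => collective n x.1)
        (lindblad hH hbar (fun μ => collective n (μ.gen (c μ))) Γ)) ∧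
    -- ensembles of `n` particles with spin `N / 2`, any Hamiltonian in the algebra of the
    -- collective spin operators
    (∀ (N : ℕ) (H : Matrix (Fin n → Fin (N + 1)) (Fin n → Fin (N + 1)) ℂ) (hH : H.IsHermitian)
        (Γ : ℝ → Matrix (SuRoot 2) (SuRoot 2) ℂ) (R : Finset (SuRoot 2)),
      H ∈ Algebra.adjoin ℂ (Set.range fun a => collective n (spinXYZ N a)) →
      IsSimpleRoots R →
      RatesFullRank hH hbar (fun μ => collective n (spinLadder N μ)) Γ R →
      SteadyStatesHaveSchurForm (fun a => collective n (spinXYZ N a))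
        (lindblad hH hbar (fun μ => collective n (spinLadder N μ)) Γ)) := by
  refine ⟨fun d H hH c Γ R hinv hc _ hR hΓ => ?_, fun N H hH Γ R hHX hR hΓ => ?_⟩
  · have hle : Algebra.adjoin ℂ (Set.range (collective n (d := d))) ≤
        Algebra.adjoin ℂ (Set.range fun x : SuGenerator d => collective n x.1) := by
      refine Algebra.adjoin_le ?_
      rintro _ ⟨x, rfl⟩
      exact collective_mem_adjoin_suGenerator x
    refine steadyStatesHaveSchurForm_lindblad hH hhbar.ne' (fun x => ?_) (hle hinv.mem_adjoin)
      (fun μ => collective_mem_adjoin_suGenerator _) (suGenerator_mem_adjoin hc hR) hΓ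
    rw [Matrix.IsHermitian, collective_conjTranspose, x.2.1.eq]
  · refine steadyStatesHaveSchurForm_lindblad hH hhbar.ne' (fun a => ?_) hHX
      collective_spinLadder_mem_adjoin (collective_spinXYZ_mem_adjoin hR) hΓ
    rw [Matrix.IsHermitian, collective_conjTranspose, (spinXYZ_isHermitian N a).eq]
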